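/- For a finite simple graph $G$ and an integer $k\ge 2$, let $f_k(G)$ be the minimum cardinality of a set $X$ of vertices of $G$ such that $G-X$ has at least $k$ vertices of maximum degree or has order less than $k$. Theorem. For every fixed integer $k\ge 2$, the value $f_k(F)$ can be determined in polynomial time for a given finite forest $F$. That is, for every $k\geq 2$ there are a deterministic (multi-stack) Turing machine $M_k$ and a polynomial $p_k$ such that, for every finite forest $F$ with vertex set $\{0,\ldots,n-1\}$, given as the string consisting of $n$ in unary, a separator, and the $n^2$ bits of the adjacency matrix of $F$ row by row, the machine $M_k$ halts after at most $p_k(L)$ steps, where $L=n+1+n^2$ is the length of the input, with output $f_k(F)$ written in unary. -/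

import Mathlib

/-- The number of vertices of maximum degree of a finite graph. -/
noncomputable def numMaxDegree {V : Type*} [Fintype V] (G : SimpleGraph V) : ℕ :=
  open Classical in (Finset.univ.filter fun v : V => G.degree v = G.maxDegree).card

/-- `G - X` has (at least) `k` vertices of maximum degree, or order less than `k`. -/
def IsEquatingSet {V : Type*} [Fintype V] (k : ℕ) (G : SimpleGraph V) (X : Finset V) : Prop :=
  open Classical in
  k ≤ numMaxDegree (G.induce {v : V | v ∉ X}) ∨ Fintype.card {v : V // v ∉ X} < k

/-- `f_k(G)`: the minimum cardinality of a set `X` of vertices of `G` such that `G - X` has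
either `k` vertices of maximum degree or order less than `k`. -/
noncomputable def equatingNumber {V : Type*} [Fintype V] (k : ℕ) (G : SimpleGraph V) : ℕ :=
  sInf {m : ℕ | ∃ X : Finset V, IsEquatingSet k G X ∧ X.card = m}

/-- For `k ≥ 1` the minimum defining `f_k(G)` is attained. -/
theorem exists_card_eq_equatingNumber {V : Type*} [Fintype V] (k : ℕ) (hk : 1 ≤ k)
    (G : SimpleGraph V) : ∃ X : Finset V, IsEquatingSet k G X ∧ X.card = equatingNumber k G := by
  refine Nat.sInf_mem (s := {m : ℕ | ∃ X : Finset V, IsEquatingSet k G X ∧ X.card = m})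
    ⟨_, Finset.univ, Or.inr ?_, rfl⟩
  simpa using (by omega : 0 < k)

/-- A finite forest, with vertex set `{0, …, order - 1}`: an instance of the algorithmic problem. -/
structure FiniteForest where
  order : ℕ
  graph : SimpleGraph (Fin order)
  isAcyclic : graph.IsAcyclic

/-- The adjacency matrix of a graph on `{0, …, n - 1}`, written row by row. -/
noncomputable def adjacencyBits {n : ℕ} (G : SimpleGraph (Fin n)) : List Bool :=
  open Classical in
  (List.finRange n).flatMap fun i => (List.finRange n).map fun j => decide (G.Adj i j)

/-- The input string of a forest: the order in unary, ended by a `false`, and then the bits of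
the adjacency matrix. For a forest of order `n` it has length `n + 1 + n ^ 2`. -/
noncomputable def encodeForest (F : FiniteForest) : List Bool :=
  List.replicate F.order true ++ false :: adjacencyBits F.graph

theorem length_encodeForest (F : FiniteForest) :
    (encodeForest F).length = F.order + 1 + F.order ^ 2 := by
  simp [encodeForest, adjacencyBits, List.length_flatMap]
  ring

/-- Different forests have different input strings. -/
theorem encodeForest_injective : Function.Injective encodeForest := by
  have key : ∀ {α : Type} (l : List α) (f g : α → List Bool),
      (∀ a, (f a).length = (g a).length) → l.flatMap f = l.flatMap g → ∀ a ∈ l, f a = g a := by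
    intro α l f g hl
    induction l with
    | nil => simp
    | cons b l ih =>
      intro h a ha
      rw [List.flatMap_cons, List.flatMap_cons] at h
      obtain ⟨h1, h2⟩ := List.append_inj h (hl b)
      rcases List.mem_cons.1 ha with rfl | ha
      · exact h1
      · exact ih h2 a ha
  rintro ⟨n, G, hG⟩ ⟨m, H, hH⟩ h
  have hnm : n = m := by
    have h' := congrArg List.length h
    simp only [length_encodeForest] at h'
    nlinarith
  subst hnm
  have h2 : adjacencyBits G = adjacencyBits H := by simpa [encodeForest] using h
  have : G = H := by
    ext i j
    have h3 := key _ _ _ (by simp) h2 i (by simp)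
    have h4 := List.map_inj_left.1 h3 j (by simp)
    simpa using h4
  subst this
  rfl

/-! For `k ≥ 1`, the graph induced on a kept set `K` has at least `k` vertices of maximum degree
iff, for some `d`, all its degrees are at most `d` and at least `k` of them equal `d`. So it
suffices to know, for each `d`, which pairs (number of vertices of degree `d`, number of deleted
vertices) occur among the sets `K` with all degrees at most `d`.

In a forest this is a dynamic programme along an elimination order. Every nonempty induced subgraph
has a vertex `v` with at most one neighbour. Its piece, the vertices merged into it so far, is
merged into the piece of that neighbour `p`, or into a virtual vertex `n` if there is none. At most
the edge `pv` joins the two pieces. Hence a choice of kept vertices in a piece is summarised by few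
numbers: the status and degree of the root, how many other vertices have degree `d`, and how many
are deleted (`merge_iff`, `meaning_merge`). After `n` rounds everything lies in the piece of `n`
(`iterate_nextTable`), and `isLeast_good` reads off the minimum. All entries are at most `n`, so the
table has polynomial size, with an exponent independent of `k`.

For the machine, the update rule is written with bounded quantifiers, that is, as an arithmetical
expression with bounded sums and table look-up. The values of such an expression are bounded by a
polynomial, so a program on unary stacks evaluates it in polynomial time (`runsIn_compile`).
Expressions alone cannot iterate a rule; a driver therefore rewrites a working table a polynomial
number of times, its length being bounded independently of the round (`runsIn_resultCmd`).
Structured programs translate into multi-stack Turing machines step for step (`Run.reachesIn`). -/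

namespace StackProg

/-! ### Structured stack programs and their translation into Turing machines. -/

open Turing Function

/-- Structured programs acting on finitely many stacks of bits, indexed by `κ`. -/
inductive Cmd (κ : Type) : Type
  | skip : Cmd κ
  | push (k : κ) (b : Bool) : Cmd κ
  | seq (c d : Cmd κ) : Cmd κ
  | casePop (k : κ) (onEmpty : Cmd κ) (body : Bool → Cmd κ) : Cmd κ
  | loopPop (k : κ) (body : Bool → Cmd κ) : Cmd κ

namespace Cmd

variable {κ : Type} [DecidableEq κ]

/-- Big-step semantics: `Run c S S' t` says that `c` takes the stacks `S` to `S'` in `t` steps. -/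
inductive Run : Cmd κ → (κ → List Bool) → (κ → List Bool) → ℕ → Prop
  | skip (S) : Run skip S S 1
  | push (k b S) : Run (push k b) S (update S k (b :: S k)) 1
  | seq {c d S S' S'' t t'} : Run c S S' t → Run d S' S'' t' → Run (seq c d) S S'' (t + t')
  | casePop_nil {k c body S S' t} : S k = [] → Run c S S' t → Run (casePop k c body) S S' (t + 1)
  | casePop_cons {k c body S S' t b l} : S k = b :: l → Run (body b) (update S k l) S' t →
      Run (casePop k c body) S S' (t + 1)
  | loopPop_nil {k body S} : S k = [] → Run (loopPop k body) S S 1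
  | loopPop_cons {k body S S' S'' t t' b l} : S k = b :: l → Run (body b) (update S k l) S' t →
      Run (loopPop k body) S' S'' t' → Run (loopPop k body) S S'' (t + t' + 1)

/-- The stacks that a program uses. -/
def regs : Cmd κ → Finset κ
  | skip => ∅
  | push k _ => {k}
  | seq c d => c.regs ∪ d.regs
  | casePop k c body => {k} ∪ c.regs ∪ (body true).regs ∪ (body false).regs
  | loopPop k body => {k} ∪ (body true).regs ∪ (body false).regs

/-- The labels of the machine that executes a program. -/
def Lab : Cmd κ → Type
  | skip => Unit
  | push _ _ => Unit
  | seq c d => c.Lab ⊕ d.Lab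
  | casePop _ c body => Unit ⊕ c.Lab ⊕ (b : Bool) × (body b).Lab
  | loopPop _ body => Unit ⊕ (b : Bool) × (body b).Lab

/-- There are finitely many labels. -/
@[reducible] def labFintype : (c : Cmd κ) → Fintype c.Lab
  | skip => inferInstanceAs (Fintype Unit)
  | push _ _ => inferInstanceAs (Fintype Unit)
  | seq c d =>
    have := c.labFintype
    have := d.labFintype
    inferInstanceAs (Fintype (c.Lab ⊕ d.Lab))
  | casePop _ c body =>
    have := c.labFintype
    have := fun b => (body b).labFintype
    inferInstanceAs (Fintype (Unit ⊕ c.Lab ⊕ (b : Bool) × (body b).Lab))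
  | loopPop _ body =>
    have := fun b => (body b).labFintype
    inferInstanceAs (Fintype (Unit ⊕ (b : Bool) × (body b).Lab))

/-- The label at which the execution of a program starts. -/
def entry : (c : Cmd κ) → c.Lab
  | skip => ()
  | push _ _ => ()
  | seq c _ => Sum.inl c.entry
  | casePop _ _ _ => Sum.inl ()
  | loopPop _ _ => Sum.inl ()

/-- The machine code of a program, with labels embedded by `emb` into a larger set of labels, and
continuing at the label `exit`. -/
def code {K' Λ : Type} (r : κ → K') : (c : Cmd κ) → (c.Lab → Λ) → Λ → c.Lab →
    TM2.Stmt (fun _ : K' => Bool) Λ (Option Bool)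
  | skip, _, exit, _ => .goto fun _ => exit
  | push k b, _, exit, _ => .push (r k) (fun _ => b) (.goto fun _ => exit)
  | seq c d, emb, exit, l =>
    match l with
    | Sum.inl l => code r c (emb ∘ Sum.inl) (emb (Sum.inr d.entry)) l
    | Sum.inr l => code r d (emb ∘ Sum.inr) exit l
  | casePop k c body, emb, exit, l =>
    match l with
    | Sum.inl _ => .pop (r k) (fun _ o => o) (.goto fun o =>
        match o with
        | none => emb (Sum.inr (Sum.inl c.entry))
        | some b => emb (Sum.inr (Sum.inr ⟨b, (body b).entry⟩)))
    | Sum.inr (Sum.inl l) => code r c (emb ∘ Sum.inr ∘ Sum.inl) exit l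
    | Sum.inr (Sum.inr ⟨b, l⟩) => code r (body b) (fun l => emb (Sum.inr (Sum.inr ⟨b, l⟩))) exit l
  | loopPop k body, emb, exit, l =>
    match l with
    | Sum.inl _ => .pop (r k) (fun _ o => o) (.goto fun o =>
        match o with
        | none => exit
        | some b => emb (Sum.inr ⟨b, (body b).entry⟩))
    | Sum.inr ⟨b, l⟩ => code r (body b) (fun l => emb (Sum.inr ⟨b, l⟩)) (emb (Sum.inl ())) l

section Compile

variable {K' Λ : Type} [DecidableEq K'] {r : κ → K'} {ι : K' → κ}

/-- Reachability in an exact number of steps, up to the internal state of the machine. -/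
def ReachesIn (m : Λ → TM2.Stmt (fun _ : K' => Bool) Λ (Option Bool)) (t : ℕ) (l : Λ)
    (S : K' → List Bool) (l' : Λ) (S' : K' → List Bool) : Prop :=
  ∀ v, ∃ v', (flip bind (TM2.step m))^[t] (some ⟨some l, v, S⟩) = some ⟨some l', v', S'⟩

theorem ReachesIn.trans {m : Λ → TM2.Stmt (fun _ : K' => Bool) Λ (Option Bool)} {t t' l l' l''
    S S' S''} (h : ReachesIn m t l S l' S') (h' : ReachesIn m t' l' S' l'' S'') :
    ReachesIn m (t + t') l S l'' S'' := fun v => by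
  obtain ⟨v', hv⟩ := h v
  obtain ⟨v'', hv'⟩ := h' v'
  exact ⟨v'', by rw [add_comm, iterate_add_apply, hv, hv']⟩

/-- A machine has finitely many stacks while `κ` may be infinite. Here `ι` includes the stacks of
the machine, and `r` inverts it on those that the program uses. -/
theorem update_comp_section (hι : Injective ι) (S : κ → List Bool) (k : κ) (hk : ι (r k) = k) (l) :
    update S k l ∘ ι = update (S ∘ ι) (r k) l := by
  funext j
  by_cases h : j = r k
  · subst h; simp [hk]
  · have : ι j ≠ k := fun h' => h (hι (h'.trans hk.symm))
    simp [h, this]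

/-- Induction on the run, with exact step counts. Sequencing is free, because the exit label of the
first command is the entry of the second; a test costs one pop; the body of a loop exits to the head
of the loop. The embedding of labels is arbitrary so that the induction hypothesis applies to
subprograms. -/
theorem Run.reachesIn {c : Cmd κ} {S S' : κ → List Bool} {t : ℕ} (h : Run c S S' t)
    (hι : Injective ι) (m : Λ → TM2.Stmt (fun _ : K' => Bool) Λ (Option Bool))
    (emb : c.Lab → Λ) (exit : Λ) (hr : ∀ k ∈ c.regs, ι (r k) = k)
    (hm : ∀ l, m (emb l) = code r c emb exit l) :
    ReachesIn m t (emb c.entry) (S ∘ ι) exit (S' ∘ ι) := by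
  induction h generalizing exit with
  | skip S => exact fun v => ⟨v, by simp [flip, hm, code]⟩
  | push k b S =>
    refine fun v => ⟨v, ?_⟩
    have hk := hr k (by simp [regs])
    simp [flip, hm, code, update_comp_section hι S k hk, hk]
  | seq h1 h2 ih1 ih2 =>
    exact (ih1 (emb ∘ Sum.inl) _ (fun k hk => hr k (by simp [regs, hk]))
        (fun l => hm (Sum.inl l))).trans
      (ih2 (emb ∘ Sum.inr) _ (fun k hk => hr k (by simp [regs, hk])) (fun l => hm (Sum.inr l)))
  | @casePop_nil k c body S S' t hS h ih =>
    have hk := hr k (by simp [regs])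
    rw [add_comm]
    refine ReachesIn.trans ?_ (ih (emb ∘ Sum.inr ∘ Sum.inl) _
      (fun k hk => hr k (by simp [regs, hk])) (fun l => hm _))
    refine fun v => ⟨none, ?_⟩
    -- Popping an empty stack writes back its tail, which is again empty.
    have : update (S ∘ ι) (r k) [] = S ∘ ι := by
      rw [← update_comp_section hι S k hk, ← hS, update_eq_self]
    refine (congrArg (fun q => some (TM2.stepAux q v (S ∘ ι))) (hm (entry _))).trans ?_
    simp [code, entry, hk, hS, this]
    rfl
  | @casePop_cons k c body S S' t b l hS h ih =>
    have hk := hr k (by simp [regs])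
    rw [add_comm]
    refine ReachesIn.trans ?_ (ih (fun l => emb (Sum.inr (Sum.inr ⟨b, l⟩))) _
      (fun k hk => hr k (by cases b <;> simp [regs, hk])) (fun l => hm _))
    refine fun v => ⟨some b, ?_⟩
    refine (congrArg (fun q => some (TM2.stepAux q v (S ∘ ι))) (hm (entry _))).trans ?_
    simp [code, entry, hk, hS, update_comp_section hι S k hk]
  | @loopPop_nil k body S hS =>
    have hk := hr k (by simp [regs])
    have : update (S ∘ ι) (r k) [] = S ∘ ι := by
      rw [← update_comp_section hι S k hk, ← hS, update_eq_self]
    refine fun v => ⟨none, ?_⟩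
    refine (congrArg (fun q => some (TM2.stepAux q v (S ∘ ι))) (hm (entry _))).trans ?_
    simp [code, entry, hk, hS, this]
  | @loopPop_cons k body S S' S'' t t' b l hS h h' ih ih' =>
    have hk := hr k (by simp [regs])
    rw [add_comm]
    refine ReachesIn.trans ?_ ((ih (fun l => emb (Sum.inr ⟨b, l⟩)) _
      (fun k hk => hr k (by cases b <;> simp [regs, hk])) (fun l => hm _)).trans
      (ih' emb exit hr hm))
    refine fun v => ⟨some b, ?_⟩
    refine (congrArg (fun q => some (TM2.stepAux q v (S ∘ ι))) (hm (entry _))).trans ?_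
    simp [code, entry, hk, hS, update_comp_section hι S k hk]

end Compile

/-- The Turing machine that executes a program. -/
noncomputable def machine (c : Cmd κ) (kin kout : κ) : FinTM2 :=
  letI := c.labFintype
  let Z : Finset κ := c.regs ∪ {kin, kout}
  { K := {k // k ∈ Z}
    k₀ := ⟨kin, by simp [Z]⟩
    k₁ := ⟨kout, by simp [Z]⟩
    Γ := fun _ => Bool
    Λ := Option c.Lab
    main := some c.entry
    σ := Option Bool
    initialState := none
    m := fun l =>
      match l with
      | none => .load (fun _ => none) .halt
      | some l => code (fun k => if h : k ∈ Z then ⟨k, h⟩ else ⟨kin, by simp [Z]⟩) c some none l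
    Γk₀Fin := inferInstanceAs (Fintype Bool) }

/-- A function computed by a program in polynomial time is computed by a Turing machine in
polynomial time. -/
theorem nonempty_tm2ComputableInPolyTime {α β : Type} {ea : α → List Bool} {eb : β → List Bool}
    {f : α → β} (c : Cmd κ) (kin kout : κ) (p : Polynomial ℕ)
    (h : ∀ a, ∃ t ≤ p.eval (ea a).length,
      Run c (update (fun _ => []) kin (ea a)) (update (fun _ => []) kout (eb (f a))) t) :
    Nonempty (TM2ComputableInPolyTime ea eb f) := by
  refine ⟨{ tm := c.machine kin kout, inputAlphabet := Equiv.refl Bool,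
            outputAlphabet := Equiv.refl Bool, time := p + 1, outputsFun := fun a => ?_ }⟩
  have h' : ∃ t ≤ p.eval (ea a).length,
      (flip bind (c.machine kin kout).step)^[t + 1]
        (some (initList (c.machine kin kout) (ea a)))
      = some (haltList (c.machine kin kout) (eb (f a))) := by
    obtain ⟨t, ht, hrun⟩ := h a
    refine ⟨t, ht, ?_⟩
    obtain ⟨v', hv⟩ := hrun.reachesIn (r := fun k =>
      if h : k ∈ c.regs ∪ {kin, kout} then (⟨k, h⟩ : {k // k ∈ c.regs ∪ {kin, kout}})
      else ⟨kin, by simp⟩) Subtype.val_injective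
      (c.machine kin kout).m some none (fun k hk => by simp [hk]) (fun l => rfl) none
    have h1 : initList (c.machine kin kout) (ea a) = ⟨some (some c.entry), none,
        update (fun _ => []) kin (ea a) ∘ Subtype.val⟩ := by
      unfold initList machine
      congr 1
      funext k
      by_cases hk : k = ⟨kin, by simp⟩
      · subst hk; simp
      · have : k.1 ≠ kin := fun h => hk (Subtype.ext h)
        simp [hk, this]
    have h2 : haltList (c.machine kin kout) (eb (f a)) = ⟨none, none,
        update (fun _ => []) kout (eb (f a)) ∘ Subtype.val⟩ := by
      unfold haltList machine
      congr 1
      funext k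
      by_cases hk : k = ⟨kout, by simp⟩
      · subst hk; simp
      · have : k.1 ≠ kout := fun h => hk (Subtype.ext h)
        simp [hk, this]
    -- The additional step is taken at the label `none`: it resets the internal state, as `haltList`
    -- requires, and halts.
    rw [iterate_succ_apply', h1, h2]
    refine (congrArg _ hv).trans ?_
    rfl
  choose t ht h using h'
  exact { steps := t + 1
          evals_in_steps := (congrArg₂ (fun x y => (flip bind (c.machine kin kout).step)^[t + 1]
            (some (initList (c.machine kin kout) x)) = some (haltList (c.machine kin kout) y))
            (List.map_id (ea a)) (List.map_id (eb (f a)))).mpr h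
          steps_le_m := by simpa using ht }

end Cmd

end StackProg

/-! ### Running times of elementary programs. -/

namespace StackProg

open Function

namespace Cmd

variable {κ : Type} [DecidableEq κ] {c d : Cmd κ} {S S' S'' : κ → List Bool} {k k' : κ} {T T' : ℕ}

/-- `c` takes the stacks `S` to `S'` in at most `T` steps. -/
def RunsIn (c : Cmd κ) (S S' : κ → List Bool) (T : ℕ) : Prop :=
  ∃ t ≤ T, Run c S S' t

theorem RunsIn.congr (h : RunsIn c S S' T) (hS : S' = S'') (hT : T ≤ T') : RunsIn c S S'' T' := by
  obtain ⟨t, ht, h⟩ := h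
  exact ⟨t, ht.trans hT, hS ▸ h⟩

theorem runsIn_skip : RunsIn skip S S 1 := ⟨1, le_rfl, .skip S⟩

theorem runsIn_push {b : Bool} : RunsIn (push k b) S (update S k (b :: S k)) 1 :=
  ⟨1, le_rfl, .push k b S⟩

theorem RunsIn.seq (h : RunsIn c S S' T) (h' : RunsIn d S' S'' T') :
    RunsIn (seq c d) S S'' (T + T') := by
  obtain ⟨t, ht, h⟩ := h
  obtain ⟨t', ht', h'⟩ := h'
  exact ⟨t + t', by omega, .seq h h'⟩

theorem RunsIn.casePop_nil {body : Bool → Cmd κ} (hS : S k = []) (h : RunsIn c S S' T) :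
    RunsIn (casePop k c body) S S' (T + 1) := by
  obtain ⟨t, ht, h⟩ := h
  exact ⟨t + 1, by omega, .casePop_nil hS h⟩

theorem RunsIn.casePop_cons {body : Bool → Cmd κ} {b : Bool} {l : List Bool} (hS : S k = b :: l)
    (h : RunsIn (body b) (update S k l) S' T) : RunsIn (casePop k c body) S S' (T + 1) := by
  obtain ⟨t, ht, h⟩ := h
  exact ⟨t + 1, by omega, .casePop_cons hS h⟩

theorem RunsIn.loopPop_nil {body : Bool → Cmd κ} (hS : S k = []) :
    RunsIn (loopPop k body) S S 1 :=
  ⟨1, le_rfl, .loopPop_nil hS⟩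

theorem RunsIn.loopPop_cons {body : Bool → Cmd κ} {b : Bool} {l : List Bool} (hS : S k = b :: l)
    (h : RunsIn (body b) (update S k l) S' T) (h' : RunsIn (loopPop k body) S' S'' T') :
    RunsIn (loopPop k body) S S'' (T + T' + 1) := by
  obtain ⟨t, ht, h⟩ := h
  obtain ⟨t', ht', h'⟩ := h'
  exact ⟨t + t' + 1, by omega, .loopPop_cons hS h h'⟩

/-- A loop that counts down a unary register. -/
theorem RunsIn.loopPop_unary {body : Bool → Cmd κ} (f : ℕ → κ → List Bool) (n : ℕ)
    (hf : ∀ i ≤ n, f i k = List.replicate i true)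
    (h : ∀ i < n, RunsIn (body true) (update (f (i + 1)) k (List.replicate i true)) (f i) T) :
    RunsIn (loopPop k body) (f n) (f 0) (n * (T + 1) + 1) := by
  induction n with
  | zero => exact (loopPop_nil (by simpa using hf 0 le_rfl)).congr rfl (by omega)
  | succ n ih =>
    refine (loopPop_cons (by simpa [List.replicate_succ] using hf (n + 1) le_rfl) (h n (by omega))
      (ih (fun i hi => hf i (by omega)) (fun i hi => h i (by omega)))).congr rfl (by nlinarith)

/-- A loop that counts down a unary register, and pushes onto another one. -/
theorem RunsIn.loopPop_accumulate {body : Bool → Cmd κ} (hk : k ≠ k') (S : κ → List Bool)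
    (g : ℕ → ℕ) (n : ℕ) (l : List Bool)
    (h : ∀ i < n, ∀ l, RunsIn (body true) (update (update S k (List.replicate i true)) k' l)
      (update (update S k (List.replicate i true)) k' (List.replicate (g i) true ++ l)) T) :
    RunsIn (loopPop k body) (update (update S k (List.replicate n true)) k' l)
      (update (update S k []) k' (List.replicate (∑ i ∈ Finset.range n, g i) true ++ l))
      (n * (T + 1) + 1) := by
  induction n generalizing l with
  | zero =>
    refine (loopPop_nil ?_).congr ?_ (by omega)
    · simp [hk]
    · simp
  | succ n ih =>
    refine (loopPop_cons (b := true) (l := List.replicate n true) ?_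
      (S' := update (update S k (List.replicate n true)) k' (List.replicate (g n) true ++ l))
      ((congrArg (fun S₁ => RunsIn (body true) S₁ _ T) ?_).mp (h n (by omega) l))
      (ih (List.replicate (g n) true ++ l) fun i hi => h i (by omega))).congr ?_ (by nlinarith)
    · simp [hk, List.replicate_succ]
    · rw [update_comm hk]; simp [update_comm hk]
    · rw [Finset.sum_range_succ, List.replicate_add, List.append_assoc]

/-- Move the content of a stack to another stack, reversing it. -/
def move (k k' : κ) : Cmd κ := loopPop k fun b => push k' b

theorem runsIn_move (hk : k ≠ k') :
    RunsIn (move k k') S (update (update S k []) k' ((S k).reverse ++ S k'))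
      (2 * (S k).length + 1) := by
  generalize hl : S k = l
  induction l generalizing S with
  | nil =>
    refine (RunsIn.loopPop_nil hl).congr ?_ (by omega)
    rw [← hl, update_eq_self, hl]; simp
  | cons b l ih =>
    refine (RunsIn.loopPop_cons hl runsIn_push (ih ?_)).congr ?_ (by simp; omega)
    · simp [hk]
    · ext1 j
      by_cases h1 : j = k' <;> by_cases h2 : j = k <;> simp_all [update_apply]

/-- Empty a stack. -/
def clear (k : κ) : Cmd κ := loopPop k fun _ => skip

theorem runsIn_clear : RunsIn (clear k) S (update S k []) (2 * (S k).length + 1) := by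
  generalize hl : S k = l
  induction l generalizing S with
  | nil =>
    refine (RunsIn.loopPop_nil hl).congr ?_ (by omega)
    rw [← hl, update_eq_self]
  | cons b l ih =>
    exact (RunsIn.loopPop_cons hl runsIn_skip (ih (by simp))).congr (by simp) (by simp; omega)

/-- Push `n` times `true`. -/
def pushes (k : κ) : ℕ → Cmd κ
  | 0 => skip
  | n + 1 => seq (push k true) (pushes k n)

theorem runsIn_pushes (n : ℕ) :
    RunsIn (pushes k n) S (update S k (List.replicate n true ++ S k)) (n + 1) := by
  induction n generalizing S with
  | zero => exact runsIn_skip.congr (by simp) le_rfl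
  | succ n ih =>
    refine (runsIn_push.seq ih).congr ?_ (by omega)
    simp [List.replicate_succ']

end Cmd

/-! ### Arithmetical expressions with bounded sums, and their compilation. -/

/-- The stacks of the programs that evaluate arithmetical expressions. -/
inductive Reg : Type
  | tab (s : Bool)
  | out
  | aux
  | var (i : ℕ)
  | tmp (i : ℕ)
  deriving DecidableEq

/-- Arithmetical expressions: bounded sums and look-up in two tables of bits. -/
inductive Expr : Type
  | var (i : ℕ)
  | const (c : ℕ)
  | add (a b : Expr)
  | mul (a b : Expr)
  | sub (a b : Expr)
  | bit (s : Bool) (a : Expr)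
  | sum (i : ℕ) (a b : Expr)

namespace Expr

/-- The value of an expression; `sum i a b` is the sum of `b` over all values less than `a` of the
variable `i`. -/
def eval (τ : Bool → List Bool) : Expr → (ℕ → ℕ) → ℕ
  | var i, σ => σ i
  | const c, _ => c
  | add a b, σ => a.eval τ σ + b.eval τ σ
  | mul a b, σ => a.eval τ σ * b.eval τ σ
  | sub a b, σ => a.eval τ σ - b.eval τ σ
  | bit s a, σ => ((τ s).getD (a.eval τ σ) false).toNat
  | sum i a b, σ => ∑ x ∈ Finset.range (a.eval τ σ), b.eval τ (update σ i x)

/-- A bound for the values of an expression. -/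
noncomputable def valBound : Expr → Polynomial ℕ
  | var _ => .X
  | const c => .C c
  | add a b => a.valBound + b.valBound
  | mul a b => a.valBound * b.valBound
  | sub a _ => a.valBound
  | bit _ _ => 1
  | sum _ a b => a.valBound * b.valBound.comp (.X + a.valBound)

/-- A bound for the number of steps that the evaluation of an expression takes. -/
noncomputable def timeBound : Expr → Polynomial ℕ
  | var _ => 5 * .X + 2
  | const c => .C c + 1
  | add a b => a.timeBound + b.timeBound
  | mul a b => a.timeBound + (a.valBound * (b.timeBound + 1) + 1)
  | sub a b => a.timeBound + b.timeBound + (b.valBound * 3 + 1) + (2 * a.valBound + 1)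
  | bit _ a => a.timeBound + (a.valBound * 3 + 1) + 3 + (2 * .X + 1)
  | sum _ a b => a.timeBound + (2 * .X + 1) + (2 * a.valBound + 1) +
      (a.valBound * (b.timeBound.comp (.X + a.valBound) + 1) + 1) + (2 * .X + 1)

/-- Sums, products and bounded sums preserve polynomial growth, and look-up yields at most `1`; this
is what makes unary evaluation affordable. -/
theorem eval_le_valBound (τ : Bool → List Bool) (e : Expr) {σ : ℕ → ℕ} {B : ℕ}
    (h : ∀ i, σ i ≤ B) : e.eval τ σ ≤ e.valBound.eval B := by
  induction e generalizing σ B with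
  | var i => simpa [eval, valBound] using h i
  | const c => simp [eval, valBound]
  | add a b iha ihb => simpa [eval, valBound] using Nat.add_le_add (iha h) (ihb h)
  | mul a b iha ihb => simpa [eval, valBound] using Nat.mul_le_mul (iha h) (ihb h)
  | sub a b iha ihb => simpa [eval, valBound] using (Nat.sub_le _ _).trans (iha h)
  | bit s a iha => simpa [eval, valBound] using Bool.toNat_le _
  | sum i a b iha ihb =>
    have ha := iha h
    simp only [eval, valBound, Polynomial.eval_mul, Polynomial.eval_comp, Polynomial.eval_add,
      Polynomial.eval_X]
    -- The enlarged argument dominates both the old variables and the summation variable.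
    refine (Finset.sum_le_card_nsmul _ _ (b.valBound.eval (B + a.valBound.eval B))
      fun x hx => ihb fun j => ?_).trans ?_
    · have hx := Finset.mem_range.1 hx
      have := h j
      rw [update_apply]
      split_ifs <;> omega
    · simpa using Nat.mul_le_mul ha le_rfl

open Cmd Reg

/-- The program that evaluates an expression, and pushes the value, in unary, onto `dst`. The
stacks `tmp j` with `d ≤ j` serve as temporary memory. -/
def compile : Expr → ℕ → Reg → Cmd Reg
  | var i, d, dst =>
    .seq (.loopPop (.var i) fun _ => .seq (.push (.tmp d) true) (.push dst true))
      (move (.tmp d) (.var i))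
  | const c, _, dst => pushes dst c
  | add a b, d, dst => .seq (a.compile d dst) (b.compile d dst)
  | mul a b, d, dst =>
    .seq (a.compile (d + 1) (.tmp d)) (.loopPop (.tmp d) fun _ => b.compile (d + 1) dst)
  | sub a b, d, dst =>
    .seq (a.compile (d + 2) (.tmp d)) <| .seq (b.compile (d + 2) (.tmp (d + 1))) <|
    .seq (.loopPop (.tmp (d + 1)) fun _ => .casePop (.tmp d) .skip fun _ => .skip)
      (move (.tmp d) dst)
  | bit s a, d, dst =>
    .seq (a.compile (d + 1) (.tmp d)) <|
    .seq (.loopPop (.tmp d) fun _ => .casePop (.tab s) .skip fun b => .push .aux b) <|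
    .seq (.casePop (.tab s) .skip fun b =>
      .seq (.push (.tab s) b) (cond b (.push dst true) .skip)) (move .aux (.tab s))
  | sum i a b, d, dst =>
    .seq (a.compile (d + 2) (.tmp (d + 1))) <| .seq (move (.var i) (.tmp d)) <|
    .seq (move (.tmp (d + 1)) (.var i)) <|
    .seq (.loopPop (.var i) fun _ => b.compile (d + 1) dst) (move (.tmp d) (.var i))

/-- The stacks hold the tables `τ` and the values `σ` of the variables, and the auxiliary stacks
from `d` onwards are empty. -/
structure Ready (d : ℕ) (τ : Bool → List Bool) (σ : ℕ → ℕ) (S : Reg → List Bool) : Prop where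
  tab : ∀ s, S (.tab s) = τ s
  var : ∀ i, S (.var i) = List.replicate (σ i) true
  tmp : ∀ j, d ≤ j → S (.tmp j) = []
  aux : S .aux = []

/-- A stack that may receive the value of an expression. -/
def IsTarget (d : ℕ) (dst : Reg) : Prop := dst = .out ∨ ∃ j < d, dst = .tmp j

theorem IsTarget.mono {d d' : ℕ} {dst : Reg} (h : IsTarget d dst) (hd : d ≤ d') :
    IsTarget d' dst :=
  h.imp_right fun ⟨j, hj, h⟩ => ⟨j, hj.trans_le hd, h⟩

theorem isTarget_tmp {d j : ℕ} (h : j < d) : IsTarget d (.tmp j) := Or.inr ⟨j, h, rfl⟩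

theorem Ready.mono {d d' : ℕ} {τ σ S} (h : Ready d τ σ S) (hd : d ≤ d') : Ready d' τ σ S :=
  ⟨h.tab, h.var, fun j hj => h.tmp j (hd.trans hj), h.aux⟩

/-- `Ready d` says nothing about targets. A partial result may thus lie on `dst` while further
subexpressions are evaluated. -/
theorem Ready.update {d : ℕ} {τ σ S dst} (h : Ready d τ σ S) (hdst : IsTarget d dst)
    (l : List Bool) : Ready d τ σ (update S dst l) := by
  obtain rfl | ⟨j, hj, rfl⟩ := hdst
  · exact ⟨by simpa using h.tab, by simpa using h.var, by simpa using h.tmp, by simpa using h.aux⟩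
  · refine ⟨by simpa using h.tab, by simpa using h.var, fun i hi => ?_, by simpa using h.aux⟩
    have : i ≠ j := by omega
    simpa [this] using h.tmp i hi

theorem IsTarget.ne_tmp {d j : ℕ} {dst : Reg} (h : IsTarget d dst) (hj : d ≤ j) :
    Reg.tmp j ≠ dst := by
  obtain rfl | ⟨i, hi, rfl⟩ := h
  · simp
  · simp; omega

theorem IsTarget.ne_var {d j : ℕ} {dst : Reg} (h : IsTarget d dst) : Reg.var j ≠ dst := by
  obtain rfl | ⟨i, hi, rfl⟩ := h <;> simp

theorem IsTarget.ne_tab {d : ℕ} {s : Bool} {dst : Reg} (h : IsTarget d dst) :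
    Reg.tab s ≠ dst := by
  obtain rfl | ⟨i, hi, rfl⟩ := h <;> simp

theorem IsTarget.ne_aux {d : ℕ} {dst : Reg} (h : IsTarget d dst) : Reg.aux ≠ dst := by
  obtain rfl | ⟨i, hi, rfl⟩ := h <;> simp

end Expr

end StackProg

/-! ### Correctness and running time of compiled expressions. -/

namespace StackProg

open Function

namespace Expr

open Cmd Reg

section

variable {d : ℕ} {dst : Reg} {τ : Bool → List Bool} {σ : ℕ → ℕ} {S : Reg → List Bool} {B : ℕ}

/-- Reading a stack destroys it, so the variable is counted out onto both the target and a spare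
stack, and then restored from the latter. -/
theorem runsIn_copy (hS : Ready d τ σ S) (hdst : IsTarget d dst) (i : ℕ) :
    RunsIn (.seq (.loopPop (.var i) fun _ => .seq (.push (.tmp d) true) (.push dst true))
      (move (.tmp d) (.var i))) S (update S dst (List.replicate (σ i) true ++ S dst))
      (5 * σ i + 2) := by
  have h1 : Reg.tmp d ≠ dst := hdst.ne_tmp le_rfl
  have h2 : Reg.var i ≠ dst := hdst.ne_var
  have hv := hS.var i
  have ht := hS.tmp d le_rfl
  generalize σ i = n at *
  have hloop := RunsIn.loopPop_unary (T := 2) (k := Reg.var i)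
    (body := fun _ => .seq (.push (.tmp d) true) (.push dst true))
    (fun j => update (update (update S (.var i) (List.replicate j true)) (.tmp d)
      (List.replicate (n - j) true)) dst (List.replicate (n - j) true ++ S dst)) n
    (fun j _ => by simp [h2]) (fun j hj => by
      refine (runsIn_push.seq runsIn_push).congr ?_ le_rfl
      have e : n - j = n - (j + 1) + 1 := by omega
      ext1 r
      by_cases a1 : r = dst
      · subst a1; simp [e, List.replicate_succ, h1, h1.symm, h2.symm]
      by_cases a2 : r = .tmp d
      · subst a2; simp [e, List.replicate_succ, h1]
      by_cases a3 : r = .var i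
      · subst a3; simp [h2]
      simp [a1, a2, a3])
  refine (((congrArg (fun S₁ => RunsIn _ S₁ _ _) ?_).mp hloop).seq
    (runsIn_move (by simp))).congr ?_ ?_
  · ext1 r
    by_cases a1 : r = dst
    · subst a1; simp
    by_cases a2 : r = .tmp d
    · subst a2; simp [h1, ht]
    by_cases a3 : r = .var i
    · subst a3; simp [h2, hv]
    simp [a1, a2, a3]
  · ext1 r
    by_cases a1 : r = dst
    · subst a1; simp [h1.symm, h2.symm]
    by_cases a2 : r = .tmp d
    · subst a2; simp [h1, ht]
    by_cases a3 : r = .var i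
    · subst a3; simp [h2, h1, hv]
    simp [a1, a2, a3]
  · simp [h1]; omega

/-- Subtraction of the unary register `k'` from the unary register `k`. -/
theorem runsIn_monus {k k' : Reg} (hk : k ≠ k') {m n : ℕ} (hm : S k = List.replicate m true)
    (hn : S k' = List.replicate n true) :
    RunsIn (.loopPop k' fun _ => .casePop k .skip fun _ => .skip) S
      (update (update S k' []) k (List.replicate (m - n) true)) (n * 3 + 1) := by
  induction n generalizing S m with
  | zero =>
    refine (RunsIn.loopPop_nil (by simpa using hn)).congr ?_ (by omega)
    ext1 r
    by_cases a1 : r = k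
    · subst a1; simp [hm]
    by_cases a2 : r = k'
    · subst a2; simp [a1, hn]
    simp [a1, a2]
  | succ n ih =>
    have hc : RunsIn (.casePop k .skip fun _ => .skip) (update S k' (List.replicate n true))
        (update (update S k' (List.replicate n true)) k (List.replicate (m - 1) true)) 2 := by
      cases m with
      | zero =>
        refine (RunsIn.casePop_nil (by simpa [hk] using hm) runsIn_skip).congr ?_ le_rfl
        ext1 r
        by_cases a1 : r = k
        · subst a1; simp [hm, hk]
        simp [a1]
      | succ m =>
        exact (RunsIn.casePop_cons (b := true) (l := List.replicate m true)
          (by simpa [hk, List.replicate_succ] using hm) runsIn_skip).congr (by simp) le_rfl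
    refine (RunsIn.loopPop_cons (b := true) (l := List.replicate n true)
      (by simpa [List.replicate_succ] using hn) hc (ih (m := m - 1) ?_ ?_)).congr ?_ (by omega)
    · simp
    · simp [hk.symm]
    · ext1 r
      by_cases a1 : r = k
      · subst a1; simp; omega
      by_cases a2 : r = k'
      · subst a2; simp [a1]
      simp [a1, a2]

/-- Moving `n` entries of the stack `k` to the stack `k'`. -/
theorem runsIn_dig {k k' c : Reg} (h1 : k ≠ k') (h2 : c ≠ k) (h3 : c ≠ k') {n : ℕ}
    (hn : S c = List.replicate n true) :
    RunsIn (.loopPop c fun _ => .casePop k .skip fun b => .push k' b) S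
      (update (update (update S c []) k ((S k).drop n)) k' (((S k).take n).reverse ++ S k'))
      (n * 3 + 1) := by
  induction n generalizing S with
  | zero =>
    refine (RunsIn.loopPop_nil (by simpa using hn)).congr ?_ (by omega)
    rw [← (show S c = [] by simpa using hn)]; simp
  | succ n ih =>
    rcases hl : S k with _ | ⟨b, l⟩
    -- The stack may be shorter than `n`; the surplus rounds do nothing, in accordance with `take`
    -- and `drop`.
    · have hc : RunsIn (.casePop k .skip fun b => .push k' b) (update S c (List.replicate n true))
          (update S c (List.replicate n true)) 2 :=
        RunsIn.casePop_nil (by simpa [h2.symm] using hl) runsIn_skip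
      refine (RunsIn.loopPop_cons (b := true) (l := List.replicate n true)
        (by simpa [List.replicate_succ] using hn) hc (ih ?_)).congr ?_ (by omega)
      · simp
      · simp [h2.symm, h3.symm, hl]
    · have hc : RunsIn (.casePop k .skip fun b => .push k' b) (update S c (List.replicate n true))
          (update (update (update S c (List.replicate n true)) k l) k' (b :: S k')) 2 := by
        refine (RunsIn.casePop_cons (b := b) (l := l) (by simpa [h2.symm] using hl)
          runsIn_push).congr ?_ le_rfl
        simp [h1.symm, h3.symm]
      refine (RunsIn.loopPop_cons (b := true) (l := List.replicate n true)
        (by simpa [List.replicate_succ] using hn) hc (ih ?_)).congr ?_ (by omega)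
      · simp [h2, h3]
      · ext1 r
        by_cases a1 : r = k'
        · subst a1; simp [h1]
        by_cases a2 : r = k
        · subst a2; simp [a1]
        by_cases a3 : r = c
        · subst a3; simp [a1, a2]
        simp [a1, a2, a3]

end

/-- The program of an expression computes its value in polynomial time. -/
theorem runsIn_compile (e : Expr) {d : ℕ} {dst : Reg} {τ : Bool → List Bool} {σ : ℕ → ℕ}
    {S : Reg → List Bool} {B : ℕ} (hS : Ready d τ σ S) (hdst : IsTarget d dst)
    (hσ : ∀ i, σ i ≤ B) (hτ : ∀ s, (τ s).length ≤ B) :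
    RunsIn (e.compile d dst) S (update S dst (List.replicate (e.eval τ σ) true ++ S dst))
      (e.timeBound.eval B) := by
  induction e generalizing d dst σ S B with
  | var i =>
    refine (runsIn_copy hS hdst i).congr rfl ?_
    have := hσ i
    simp [timeBound]; omega
  | const c => exact (runsIn_pushes c).congr rfl (by simp [timeBound])
  | add a b iha ihb =>
    refine ((iha hS hdst hσ hτ).seq (ihb (hS.update hdst _) hdst hσ hτ)).congr ?_
      (by simp [timeBound])
    simp only [update_idem, update_self, eval, ← List.append_assoc,
      List.replicate_append_replicate, add_comm (a.eval τ σ)]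
  | mul a b iha ihb =>
    have h1 : Reg.tmp d ≠ dst := hdst.ne_tmp le_rfl
    have hT : IsTarget (d + 1) (.tmp d) := isTarget_tmp (by omega)
    -- Multiplication is repeated evaluation: `b` is evaluated anew, onto `dst`, for each unit of
    -- the value of `a`.
    have hloop := RunsIn.loopPop_accumulate (body := fun _ => b.compile (d + 1) dst) h1 S
      (fun _ => b.eval τ σ) (a.eval τ σ) (S dst) (T := b.timeBound.eval B) (fun i _ l => by
        refine (ihb (((hS.mono (by omega)).update hT _).update (hdst.mono (by omega)) _)
          (hdst.mono (by omega)) hσ hτ).congr ?_ le_rfl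
        simp)
    refine ((iha (hS.mono (by omega)) hT hσ hτ).seq
      ((congrArg (fun S₁ => RunsIn _ S₁ _ _) ?_).mp hloop)).congr ?_ ?_
    · simp [hS.tmp d le_rfl, h1.symm]
    · rw [← hS.tmp d le_rfl]
      simp [eval]
    · have := a.eval_le_valBound τ hσ
      simp only [timeBound, Polynomial.eval_add, Polynomial.eval_mul, Polynomial.eval_one]
      gcongr
  | sub a b iha ihb =>
    have h1 : Reg.tmp d ≠ dst := hdst.ne_tmp le_rfl
    have h2 : Reg.tmp (d + 1) ≠ dst := hdst.ne_tmp (by omega)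
    have h3 := hS.tmp d le_rfl
    have h4 := hS.tmp (d + 1) (by omega)
    have hT : IsTarget (d + 2) (.tmp d) := isTarget_tmp (by omega)
    have hT' : IsTarget (d + 2) (.tmp (d + 1)) := isTarget_tmp (by omega)
    have hS' := hS.mono (show d ≤ d + 2 by omega)
    refine ((iha hS' hT hσ hτ).seq ((ihb (hS'.update hT _) hT' hσ hτ).seq
      ((runsIn_monus (m := a.eval τ σ) (n := b.eval τ σ) (by simp) (by simp [h3])
        (by simp [h4])).seq
      (runsIn_move h1)))).congr ?_ ?_
    · ext1 r
      by_cases a1 : r = dst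
      · subst a1; simp [eval, h1.symm, h2.symm]
      by_cases a2 : r = .tmp d
      · subst a2; simp [h1, h3]
      by_cases a3 : r = .tmp (d + 1)
      · subst a3; simp [h2, h4]
      simp [a1, a2, a3]
    · have ha := a.eval_le_valBound τ hσ
      have hb := b.eval_le_valBound τ hσ
      simp [timeBound]
      omega
  | bit s a iha =>
    have h1 : Reg.tmp d ≠ dst := hdst.ne_tmp le_rfl
    have h2 : Reg.tab s ≠ dst := hdst.ne_tab
    have h3 : Reg.aux ≠ dst := hdst.ne_aux
    have h4 := hS.tmp d le_rfl
    have h5 := hS.tab s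
    have h6 := hS.aux
    have hT : IsTarget (d + 1) (.tmp d) := isTarget_tmp (by omega)
    -- The entries before the wanted one go to `aux` in reverse order, which leaves that entry on
    -- top; the final move restores the table.
    have hdig := runsIn_dig (S := update S (.tmp d) (List.replicate (a.eval τ σ) true))
      (k := .tab s) (k' := .aux) (c := .tmp d) (n := a.eval τ σ) (by simp) (by simp) (by simp)
      (by simp)
    have hmid : RunsIn (.casePop (.tab s) .skip fun b =>
        .seq (.push (.tab s) b) (cond b (.push dst true) .skip))
        (update (update S (.tab s) ((τ s).drop (a.eval τ σ))) .aux
          ((τ s).take (a.eval τ σ)).reverse)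
        (update (update (update S (.tab s) ((τ s).drop (a.eval τ σ))) .aux
          ((τ s).take (a.eval τ σ)).reverse) dst
          (List.replicate ((bit s a).eval τ σ) true ++ S dst)) 3 := by
      rcases hl : (τ s).drop (a.eval τ σ) with _ | ⟨b, l⟩
      -- An index beyond the end reads the default `false`, so nothing is pushed.
      · refine (RunsIn.casePop_nil (by simp) runsIn_skip).congr ?_ (by omega)
        have : (τ s)[a.eval τ σ]? = none := by
          simpa using hl
        simp only [eval, List.getD_eq_getElem?_getD, this]
        ext1 r
        by_cases a1 : r = dst
        · subst a1; simp [h2.symm, h3.symm]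
        simp [a1]
      · have hb : (τ s)[a.eval τ σ]? = some b := by
          have := congrArg (fun l => l[0]?) hl
          simpa using this
        refine (RunsIn.casePop_cons (b := b) (l := l) (by simp) (runsIn_push.seq (T' := 1)
          (S'' := (update (update (update S (.tab s) (b :: l)) .aux
          ((τ s).take (a.eval τ σ)).reverse) dst
          (List.replicate ((bit s a).eval τ σ) true ++ S dst))) ?_)).congr rfl le_rfl
        simp only [eval, List.getD_eq_getElem?_getD, hb]
        cases b
        · refine runsIn_skip.congr ?_ le_rfl
          ext1 r
          by_cases a1 : r = dst
          · subst a1; simp [h2.symm, h3.symm]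
          by_cases a2 : r = .aux
          · subst a2; simp [h3]
          by_cases a3 : r = .tab s
          · subst a3; simp [h2]
          simp [a1, a2, a3]
        · refine runsIn_push.congr ?_ le_rfl
          ext1 r
          by_cases a1 : r = dst
          · subst a1; simp [h2.symm, h3.symm]
          by_cases a2 : r = .aux
          · subst a2; simp [h3]
          by_cases a3 : r = .tab s
          · subst a3; simp [h2]
          simp [a1, a2, a3]
    refine ((iha (hS.mono (by omega)) hT hσ hτ).seq
      (((congrArg (fun S₁ => RunsIn _ S₁ _ _) ?_).mp hdig).seq
      (((congrArg (fun S₁ => RunsIn _ S₁ _ _) ?_).mp hmid).seq (runsIn_move (by simp))))).congr ?_ ?_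
    · simp [h4]
    · ext1 r
      by_cases a2 : r = .aux
      · subst a2; simp [h5, h6]
      by_cases a3 : r = .tab s
      · subst a3; simp [h5]
      by_cases a1 : r = .tmp d
      · subst a1; simp [h4]
      simp [a1, a2, a3]
    · ext1 r
      by_cases a1 : r = dst
      · subst a1; simp [h2.symm, h3.symm]
      by_cases a2 : r = .aux
      · subst a2; simp [h3, h6]
      by_cases a3 : r = .tab s
      · subst a3; simp [h2, h3, h5]
      simp [a1, a2, a3]
    · have ha := a.eval_le_valBound τ hσ
      have := hτ s
      simp [timeBound, h3]
      omega
  | sum i a b iha ihb =>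
    have h1 : Reg.tmp d ≠ dst := hdst.ne_tmp le_rfl
    have h2 : Reg.tmp (d + 1) ≠ dst := hdst.ne_tmp (by omega)
    have h3 : Reg.var i ≠ dst := hdst.ne_var
    have h4 := hS.tmp d le_rfl
    have h5 := hS.tmp (d + 1) (by omega)
    have h6 := hS.var i
    have hT : IsTarget (d + 2) (.tmp (d + 1)) := isTarget_tmp (by omega)
    have ha := a.eval_le_valBound τ hσ
    -- The loop counter is the summation variable itself: after each pop the stack `var i` holds the
    -- current `x`. Its former value waits in `tmp d`.
    have hloop := RunsIn.loopPop_accumulate (body := fun _ => b.compile (d + 1) dst) h3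
      (update S (.tmp d) (List.replicate (σ i) true))
      (fun x => b.eval τ (update σ i x)) (a.eval τ σ) (S dst)
      (T := b.timeBound.eval (B + a.valBound.eval B)) (fun x hx l => by
        refine (ihb (σ := update σ i x) (B := B + a.valBound.eval B) ⟨?_, ?_, ?_, ?_⟩
          (hdst.mono (by omega)) ?_ ?_).congr ?_ le_rfl
        · intro s; simp [hdst.ne_tab, hS.tab]
        · intro j
          by_cases hj : j = i
          · subst hj; simp [h3]
          · simp [hj, hdst.ne_var, hS.var]
        · intro j hj
          have : j ≠ d := by omega
          simp [hdst.ne_tmp (show d ≤ j by omega), this, hS.tmp j (by omega)]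
        · simp [hdst.ne_aux, hS.aux]
        · intro j
          have := hσ j
          rw [update_apply]
          split_ifs <;> omega
        · intro s
          have := hτ s
          omega
        · simp)
    refine ((iha (hS.mono (by omega)) hT hσ hτ).seq ((runsIn_move (by simp)).seq
      ((runsIn_move (by simp)).seq (((congrArg (fun S₁ => RunsIn _ S₁ _ _) ?_).mp hloop).seq
      (runsIn_move (by simp)))))).congr ?_ ?_
    · ext1 r
      by_cases a1 : r = dst
      · subst a1; simp [h1.symm, h2.symm, h3.symm]
      by_cases a2 : r = .var i
      · subst a2; simp [h3, h5]
      by_cases a3 : r = .tmp d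
      · subst a3; simp [h1, h4, h6]
      by_cases a4 : r = .tmp (d + 1)
      · subst a4; simp [h2, h5]
      simp [a1, a2, a3, a4]
    · ext1 r
      by_cases a1 : r = dst
      · subst a1; simp [h1.symm, h3.symm, eval]
      by_cases a2 : r = .var i
      · subst a2; simp [h3, h1, h6]
      by_cases a3 : r = .tmp d
      · subst a3; simp [h1, h4]
      simp [a1, a2, a3]
    · have := hσ i
      have hm := Nat.mul_le_mul_right (b.timeBound.eval (B + a.valBound.eval B) + 1) ha
      simp [timeBound, h1, h5, h6]
      omega

end Expr

end StackProg

/-! ### Tabulating an expression, and iterating the tabulation. -/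

namespace StackProg

open Function

namespace Expr

open Cmd Reg

/-- The valuation in which the variable `0` has the value `n`, and the other variables have the
value `0`. -/
def valuation (n : ℕ) : ℕ → ℕ := update (fun _ => 0) 0 n

/-- The two tables: the input `w` and the working table `T`. -/
def tables (w T : List Bool) : Bool → List Bool := fun s => cond s T w

/-- The table of the truth values of the expression `e`, as the variable `1` ranges over the values
less than `size`. -/
def tabulate (size e : Expr) (w T : List Bool) : List Bool :=
  (List.range (size.eval (tables w T) (valuation w.length))).map fun x =>
    decide (e.eval (tables w T) (update (valuation w.length) 1 x) ≠ 0)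

/-- The stacks hold the tables `w` and `T`, and the length of `w`. -/
def store (w T : List Bool) : Reg → List Bool
  | .tab s => tables w T s
  | .var i => List.replicate (valuation w.length i) true
  | _ => []

theorem ready_store (w T : List Bool) (d : ℕ) :
    Ready d (tables w T) (valuation w.length) (store w T) :=
  ⟨fun _ => rfl, fun _ => rfl, fun _ _ => rfl, rfl⟩

theorem valuation_le (n i : ℕ) : valuation n i ≤ n := by
  unfold valuation
  rw [update_apply]
  split_ifs <;> simp

/-- The program that replaces the working table by `tabulate size e`. -/
def tabulateCmd (size e : Expr) : Cmd Reg :=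
  .seq (size.compile 2 (.tmp 1)) <| .seq (move (.tmp 1) (.var 1)) <|
  .seq (.loopPop (.var 1) fun _ => .seq (e.compile 2 (.tmp 1)) <|
    .casePop (.tmp 1) (.push .out false) fun _ => .seq (clear (.tmp 1)) (.push .out true)) <|
  .seq (clear (.tab true)) <| .seq (move .out .aux) (move .aux (.tab true))

/-- A bound for the number of steps of `tabulateCmd`. -/
noncomputable def tabulateBound (size e : Expr) : Polynomial ℕ :=
  size.timeBound + (2 * size.valBound + 1) +
    (size.valBound * ((e.timeBound + (2 * e.valBound + 3)).comp (.X + size.valBound) + 1) + 1) +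
    (2 * .X + 1) + (2 * size.valBound + 1) + (2 * size.valBound + 1)

/-- The index counts down, so pushing the bits onto `out` leaves them in increasing order, and two
moves keep that order. The old table is discarded only at the end, as `e` may consult it throughout.
The content `l` of `tmp 0` is carried along because the driver keeps its round counter there. -/
theorem runsIn_tabulateCmd (size e : Expr) (w T l : List Bool) {B : ℕ} (hw : w.length ≤ B)
    (hT : T.length ≤ B) :
    RunsIn (tabulateCmd size e) (update (store w T) (.tmp 0) l)
      (update (store w (tabulate size e w T)) (.tmp 0) l) ((tabulateBound size e).eval B) := by
  have hσ : ∀ i, valuation w.length i ≤ B := fun i => (valuation_le _ i).trans hw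
  have hτ : ∀ s, (tables w T s).length ≤ B := by rintro (_ | _) <;> assumption
  have hR : Ready 2 (tables w T) (valuation w.length) (update (store w T) (.tmp 0) l) :=
    (ready_store w T 2).update (isTarget_tmp (by omega)) l
  have hM := size.eval_le_valBound (tables w T) hσ
  have h1 := runsIn_compile size hR (isTarget_tmp (by omega : 1 < 2)) hσ hτ
  set M := size.eval (tables w T) (valuation w.length) with hMdef
  set V := size.valBound.eval B with hV
  set g : ℕ → Bool := fun x =>
    decide (e.eval (tables w T) (update (valuation w.length) 1 x) ≠ 0) with hg
  have hv : valuation w.length 1 = 0 := rfl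
  set U := e.valBound.eval (B + V) with hU
  set E := e.timeBound.eval (B + V) with hE
  have hloop := RunsIn.loopPop_unary (k := Reg.var 1) (T := E + (2 * U + 3))
    (body := fun _ => .seq (e.compile 2 (.tmp 1)) <|
      .casePop (.tmp 1) (.push .out false) fun _ => .seq (clear (.tmp 1)) (.push .out true))
    (fun i => update (update (update (store w T) (.tmp 0) l) (.var 1) (List.replicate i true)) .out
      (((List.range M).drop i).map g)) M (fun i _ => by simp) (fun i hi => by
      have hσ' : ∀ j, update (valuation w.length) 1 i j ≤ B + V := fun j => by
        have := hσ j
        rw [update_apply]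
        split_ifs <;> omega
      have hr : Ready 2 (tables w T) (update (valuation w.length) 1 i)
          (update (update (update (update (store w T) (.tmp 0) l) (.var 1)
            (List.replicate (i + 1) true)) .out (((List.range M).drop (i + 1)).map g)) (.var 1)
            (List.replicate i true)) := by
        refine ⟨fun s => by simp [store], fun j => ?_, fun j hj => ?_, by simp [store]⟩
        · by_cases hj : j = 1
          · subst hj; simp
          · simp [hj, store]
        · simp [hR.tmp j hj]
      have hdrop : (List.range M).drop i = i :: (List.range M).drop (i + 1) := by
        rw [List.drop_eq_getElem_cons (by simpa using hi)]; simp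
      have hval := e.eval_le_valBound (tables w T) hσ'
      refine ((runsIn_compile e hr (isTarget_tmp (by omega)) hσ'
        fun s => (hτ s).trans (by omega)).seq (T' := 2 * U + 3) ?_).congr rfl le_rfl
      rw [hdrop]
      rcases hv' : e.eval (tables w T) (update (valuation w.length) 1 i) with _ | v
      · refine (RunsIn.casePop_nil (by simp [store]) runsIn_push).congr ?_ (by omega)
        have hgi : g i = false := by simp [hg, hv']
        ext1 r
        by_cases a1 : r = .out
        · subst a1; simp [hgi]
        by_cases a2 : r = .var 1
        · subst a2; simp
        by_cases a3 : r = .tmp 1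
        · subst a3; simp [store]
        simp [a1, a2, a3]
      · refine (RunsIn.casePop_cons (b := true) (l := List.replicate v true)
          (by simp [store, List.replicate_succ]) (runsIn_clear.seq runsIn_push)).congr ?_ ?_
        · have hgi : g i = true := by simp [hg, hv']
          ext1 r
          by_cases a1 : r = .out
          · subst a1; simp [hgi]
          by_cases a2 : r = .var 1
          · subst a2; simp
          by_cases a3 : r = .tmp 1
          · subst a3; simp [store]
          simp [a1, a2, a3]
        · simp; omega)
  refine (h1.seq ((runsIn_move (by simp)).seq
    (((congrArg (fun S₁ => RunsIn _ S₁ _ _) ?_).mp hloop).seq (runsIn_clear.seq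
    ((runsIn_move (by simp)).seq (runsIn_move (by simp))))))).congr ?_ ?_
  · ext1 r
    by_cases a1 : r = .out
    · subst a1; simp [store]
    by_cases a2 : r = .var 1
    · subst a2; simp [store, hv]
    by_cases a3 : r = .tmp 1
    · subst a3; simp [store]
    simp [a1, a2, a3]
  · ext1 r
    by_cases a1 : r = .out
    · subst a1; simp [store]
    by_cases a2 : r = .var 1
    · subst a2; simp [store, hv]
    by_cases a3 : r = .tab true
    · subst a3; simp [store, tables, tabulate, hg, hMdef]
    by_cases a4 : r = .aux
    · subst a4; simp [store]
    by_cases a5 : r = .tmp 0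
    · subst a5; simp
    rcases r with s | _ | _ | i | i
    · cases s
      · simp [store, tables]
      · simp at a3
    all_goals simp_all [store]
  · have hm := Nat.mul_le_mul_right (E + (2 * U + 3) + 1) hM
    rw [hU, hE, hV, hMdef] at hm
    simp [tabulateBound, store, tables, hU, hE, hV, hMdef]
    omega

/-- The working table after the given number of rounds. -/
def tableAfter (size init next : Expr) (w : List Bool) (t : ℕ) : List Bool :=
  (tabulate size next w)^[t] (tabulate size init w [])

/-- The result of the program: fill the working table by the expression `init`, replace it
`rounds` times by means of the expression `next`, and evaluate `result`. -/
def result (size init next rounds result : Expr) (w : List Bool) : ℕ :=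
  result.eval (tables w (tableAfter size init next w
    (rounds.eval (tables w []) (valuation w.length)))) (valuation w.length)

/-- The program that computes `result`. -/
def resultCmd (size init next rounds result : Expr) : Cmd Reg :=
  .seq (.loopPop (.tab false) fun b => .seq (.push .aux b) (.push (.var 0) true)) <|
  .seq (move .aux (.tab false)) <| .seq (rounds.compile 1 (.tmp 0)) <|
  .seq (tabulateCmd size init) <| .seq (.loopPop (.tmp 0) fun _ => tabulateCmd size next) <|
  .seq (result.compile 1 .out) <| .seq (clear (.tab false)) <| .seq (clear (.tab true))
  (clear (.var 0))

/-- This makes the input length available to expressions as variable `0`; the input itself, reversed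
on `aux`, is moved back afterwards. -/
theorem runsIn_readInput (w : List Bool) {S : Reg → List Bool} (hS : S (.tab false) = w) :
    RunsIn (.loopPop (.tab false) fun b => .seq (.push .aux b) (.push (.var 0) true)) S
      (update (update (update S (.tab false) []) .aux (w.reverse ++ S .aux)) (.var 0)
        (List.replicate w.length true ++ S (.var 0))) (3 * w.length + 1) := by
  induction w generalizing S with
  | nil =>
    refine (RunsIn.loopPop_nil hS).congr ?_ (by omega)
    have : update S (.tab false) [] = S := by rw [← hS, update_eq_self]
    simp [this]
  | cons b w ih =>
    refine (RunsIn.loopPop_cons hS (runsIn_push.seq runsIn_push) (ih (by simp))).congr ?_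
      (by simp; omega)
    ext1 r
    by_cases a1 : r = .var 0
    · subst a1; simp [List.replicate_succ']
    by_cases a2 : r = .aux
    · subst a2; simp
    by_cases a3 : r = .tab false
    · subst a3; simp
    simp [a1, a2, a3]

theorem length_tabulate_le (size e : Expr) (w T : List Bool) :
    (tabulate size e w T).length ≤ size.valBound.eval w.length := by
  simpa [tabulate] using size.eval_le_valBound _ (valuation_le w.length)

/-- Every round produces a table of length `size`, whose polynomial bound does not involve the
previous table. Hence lengths do not compound over the rounds. -/
theorem length_tableAfter_le (size init next : Expr) (w : List Bool) (t : ℕ) :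
    (tableAfter size init next w t).length ≤ size.valBound.eval w.length := by
  cases t with
  | zero => exact length_tabulate_le _ _ _ _
  | succ t =>
    rw [tableAfter, iterate_succ_apply']
    exact length_tabulate_le _ _ _ _

/-- A bound for the number of steps of `resultCmd`. -/
noncomputable def resultBound (size init next rounds result : Expr) : Polynomial ℕ :=
  (5 * .X + 2) + rounds.timeBound + (tabulateBound size init) +
    (rounds.valBound * ((tabulateBound size next).comp (.X + size.valBound) + 1) + 1) +
    result.timeBound.comp (.X + size.valBound) + (4 * .X + 2 * size.valBound + 3)

theorem runsIn_resultCmd (size init next rounds res : Expr) (w : List Bool) :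
    RunsIn (resultCmd size init next rounds res) (update (fun _ => []) (.tab false) w)
      (update (fun _ => []) .out
        (List.replicate (result size init next rounds res w) true))
      ((resultBound size init next rounds res).eval w.length) := by
  -- A common bound for the input and for the working tables of all rounds.
  set B := w.length + size.valBound.eval w.length with hB
  have hlen := length_tableAfter_le size init next w
  have hσ := valuation_le w.length
  set R := rounds.eval (tables w []) (valuation w.length) with hR
  have hRle := rounds.eval_le_valBound (tables w []) hσ
  have h1 := runsIn_readInput w (S := update (fun _ => []) (Reg.tab false) w) (by simp)
  have h2 := runsIn_compile rounds (ready_store w [] 1) (isTarget_tmp (by omega : 0 < 1)) hσ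
    (by rintro (_ | _) <;> simp [tables])
  have h3 := runsIn_tabulateCmd size init w [] (List.replicate R true) le_rfl (by simp)
  -- Invariant: when the counter is `i`, the table has undergone `R - i` rounds.
  have hloop := RunsIn.loopPop_unary (k := Reg.tmp 0) (T := (tabulateBound size next).eval B)
    (body := fun _ => tabulateCmd size next)
    (fun i => update (store w (tableAfter size init next w (R - i))) (.tmp 0)
      (List.replicate i true)) R (fun i _ => by simp) (fun i hi => by
      refine ((congrArg (fun S₁ => RunsIn _ S₁ _ _) (update_idem _ _ _).symm).mp
        (runsIn_tabulateCmd size next w (tableAfter size init next w (R - (i + 1)))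
        (List.replicate i true) (B := B) (by omega) ?_)).congr ?_ le_rfl
      · have := hlen (R - (i + 1)); omega
      · rw [show R - i = R - (i + 1) + 1 by omega]
        conv_rhs => rw [tableAfter, iterate_succ_apply']
        rfl)
  have hz : update (store w (tableAfter size init next w R)) (.tmp 0) [] =
      store w (tableAfter size init next w R) := update_eq_self _ _
  have h4 := runsIn_compile (B := B) res (ready_store w (tableAfter size init next w R) 1)
    (Or.inl rfl) (fun i => (hσ i).trans (by omega)) (by
      have := hlen R
      rintro (_ | _) <;> simp [tables] <;> omega)
  refine (h1.seq ((runsIn_move (by simp)).seq (((congrArg (fun S₁ => RunsIn _ S₁ _ _) ?_).mp h2).seq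
    (((congrArg (fun S₁ => RunsIn _ S₁ _ _) ?_).mp h3).seq
    (((congrArg (fun S₁ => RunsIn _ S₁ _ _) ?_).mp hloop).seq
    (((congrArg (fun S₁ => RunsIn _ S₁ _ _) ?_).mp h4).seq
    (runsIn_clear.seq (runsIn_clear.seq runsIn_clear)))))))).congr ?_ ?_
  · ext1 r
    rcases r with (_ | _) | _ | _ | (_ | i) | i <;> simp [store, tables, valuation]
  · simp [store, hR]
  · simp [tableAfter]
  · simp [hz]
  · ext1 r
    rcases r with (_ | _) | _ | _ | (_ | i) | i <;>
      simp [store, valuation, result, hR]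
  · have hm := Nat.mul_le_mul_right ((tabulateBound size next).eval B + 1) hRle
    have := hlen R
    rw [← hR] at hm
    rw [resultBound]
    simp only [Polynomial.eval_add, Polynomial.eval_mul, Polynomial.eval_comp, Polynomial.eval_X,
      ← hB]
    simp [store, tables, valuation]
    omega

/-- Whatever is the result of arithmetical expressions can be computed in polynomial time. -/
theorem nonempty_tm2ComputableInPolyTime {α : Type} {ea : α → List Bool} {f : α → ℕ}
    (size init next rounds res : Expr)
    (h : ∀ a, result size init next rounds res (ea a) = f a) :
    Nonempty (Turing.TM2ComputableInPolyTime ea Computability.unaryEncodeNat f) := by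
  refine Cmd.nonempty_tm2ComputableInPolyTime (resultCmd size init next rounds res) (.tab false)
    .out (resultBound size init next rounds res) fun a => ?_
  have hu : ∀ n, Computability.unaryEncodeNat n = List.replicate n true := fun n => by
    induction n with
    | zero => rfl
    | succ n ih => rw [Computability.unaryEncodeNat, ih, List.replicate_succ]
  rw [hu, ← h]
  exact runsIn_resultCmd size init next rounds res (ea a)

end Expr

end StackProg

/-! ### Merging two pieces joined by at most one edge. -/

namespace ForestTable

open Finset

section Merge

variable (E : ℕ → ℕ → Prop)

open Classical in
/-- The number of neighbours of `v` in `K`. -/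
noncomputable def nbrs (K : Finset ℕ) (v : ℕ) : ℕ := (K.filter fun w => E v w).card

/-- All vertices of `K` other than `u` have at most `d` neighbours in `K`. -/
def Bounded (d u : ℕ) (K : Finset ℕ) : Prop := ∀ v ∈ K, v ≠ u → nbrs E K v ≤ d

/-- The number of vertices of `K` other than `u` with exactly `d` neighbours in `K`. -/
noncomputable def count (d u : ℕ) (K : Finset ℕ) : ℕ :=
  (K.filter fun v => v ≠ u ∧ nbrs E K v = d).card

open Classical in
/-- `0` if `u` does not belong to `K`, and one more than the number of neighbours otherwise. -/
noncomputable def mark (u : ℕ) (K : Finset ℕ) : ℕ := if u ∈ K then nbrs E K u + 1 else 0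

/-- How the data of two adjacent pieces determine those of their union. -/
def Merge (d y₁ c₁ y₂ c₂ y c : ℕ) : Prop :=
  (y₂ = 0 ∧ y = y₁ ∧ c = c₁ + c₂) ∨
  (0 < y₂ ∧ y₁ = 0 ∧ y₂ ≤ d + 1 ∧ y = 0 ∧
    ((y₂ = d + 1 ∧ c = c₁ + c₂ + 1) ∨ (y₂ ≠ d + 1 ∧ c = c₁ + c₂))) ∨
  (0 < y₂ ∧ 0 < y₁ ∧ y₂ ≤ d ∧ y = y₁ + 1 ∧
    ((y₂ = d ∧ c = c₁ + c₂ + 1) ∨ (y₂ ≠ d ∧ c = c₁ + c₂)))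

variable {E} {d p v : ℕ} {K₁ K₂ : Finset ℕ}

theorem nbrs_union_of_not_adj {w : ℕ} (h : ∀ b ∈ K₂, ¬E w b) :
    nbrs E (K₁ ∪ K₂) w = nbrs E K₁ w := by
  classical
  unfold nbrs
  rw [filter_union, filter_false_of_mem h, union_empty]

theorem nbrs_union_of_unique {w v : ℕ} (hv : v ∈ K₂) (hv' : v ∉ K₁) (hwv : E w v)
    (h : ∀ b ∈ K₂, E w b → b = v) : nbrs E (K₁ ∪ K₂) w = nbrs E K₁ w + 1 := by
  classical
  unfold nbrs
  have : K₂.filter (fun b => E w b) = {v} := by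
    ext b
    simp only [mem_filter, mem_singleton]
    exact ⟨fun hb => h b hb.1 hb.2, fun hb => hb ▸ ⟨hv, hwv⟩⟩
  rw [filter_union, this, card_union_of_disjoint (by simp [hv']), card_singleton]

section

-- The sets `K₁` and `K₂` are the kept parts of the pieces rooted at `p` and `v`. Adjacency of `p`
-- and `v` is only assumed when `p` is kept, so that the virtual root, which has no edges, is
-- covered too.
variable (hdisj : Disjoint K₁ K₂) (hsymm : ∀ a b, E a b → E b a)
  (hedge : ∀ a ∈ K₁, ∀ b ∈ K₂, E a b → a = p ∧ b = v) (hpv : p ∈ K₁ → E p v)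
  (hp : p ∉ K₂) (hv : v ∉ K₁)

include hedge in
theorem nbrs_union_left {a : ℕ} (ha : a ∈ K₁) (hap : a ≠ p) :
    nbrs E (K₁ ∪ K₂) a = nbrs E K₁ a :=
  nbrs_union_of_not_adj fun b hb hab => hap (hedge a ha b hb hab).1

include hsymm hedge in
theorem nbrs_union_right {b : ℕ} (hb : b ∈ K₂) (hbv : b ≠ v) :
    nbrs E (K₁ ∪ K₂) b = nbrs E K₂ b := by
  rw [union_comm]
  exact nbrs_union_of_not_adj fun a ha hab => hbv (hedge a ha b hb (hsymm _ _ hab)).2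

include hedge hpv hv in
theorem nbrs_union_root (hp1 : p ∈ K₁) :
    nbrs E (K₁ ∪ K₂) p = nbrs E K₁ p + if v ∈ K₂ then 1 else 0 := by
  split_ifs with h
  · exact nbrs_union_of_unique h hv (hpv hp1) fun b hb hab => (hedge p hp1 b hb hab).2
  · exact nbrs_union_of_not_adj fun b hb hab => h ((hedge p hp1 b hb hab).2 ▸ hb)

include hsymm hedge hpv hp in
theorem nbrs_union_child (hv2 : v ∈ K₂) :
    nbrs E (K₁ ∪ K₂) v = nbrs E K₂ v + if p ∈ K₁ then 1 else 0 := by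
  rw [union_comm]
  split_ifs with h
  · exact nbrs_union_of_unique h hp (hsymm _ _ (hpv h))
      fun a ha hab => (hedge a ha v hv2 (hsymm _ _ hab)).1
  · exact nbrs_union_of_not_adj fun a ha hab => h ((hedge a ha v hv2 (hsymm _ _ hab)).1 ▸ ha)

include hedge hpv hp hv in
theorem mark_union :
    mark E p (K₁ ∪ K₂) = if p ∈ K₁ then mark E p K₁ + (if v ∈ K₂ then 1 else 0) else 0 := by
  by_cases h : p ∈ K₁
  · simp [mark, h, nbrs_union_root hedge hpv hv h]; omega
  · simp [mark, h, hp]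

-- The root of a piece is exempt from the degree bound, since its degree may still grow. After the
-- merge `v` is no longer a root and its degree is final; the last conjunct is the check that was
-- postponed.
include hsymm hedge hpv hp hv in
theorem bounded_union : Bounded E d p (K₁ ∪ K₂) ↔ Bounded E d p K₁ ∧ Bounded E d v K₂ ∧
    (v ∈ K₂ → nbrs E K₂ v + (if p ∈ K₁ then 1 else 0) ≤ d) := by
  constructor
  · intro h
    refine ⟨fun a ha hap => ?_, fun b hb hbv => ?_, fun hv2 => ?_⟩
    · rw [← nbrs_union_left hedge ha hap]
      exact h a (mem_union_left _ ha) hap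
    · rw [← nbrs_union_right hsymm hedge hb hbv]
      exact h b (mem_union_right _ hb) fun h => hp (h ▸ hb)
    · rw [← nbrs_union_child hsymm hedge hpv hp hv2]
      exact h v (mem_union_right _ hv2) fun h => hp (h ▸ hv2)
  · rintro ⟨h1, h2, h3⟩ a ha hap
    rcases mem_union.1 ha with ha | ha
    · rw [nbrs_union_left hedge ha hap]
      exact h1 a ha hap
    · by_cases hav : a = v
      · subst hav
        rw [nbrs_union_child hsymm hedge hpv hp ha]
        exact h3 ha
      · rw [nbrs_union_right hsymm hedge ha hav]
        exact h2 a ha hav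

-- The only vertex that newly enters the count is `v`, whose degree has just become final; `p`
-- remains excluded.
include hdisj hsymm hedge hpv hp hv in
theorem count_union : count E d p (K₁ ∪ K₂) = count E d p K₁ + count E d v K₂ +
    if v ∈ K₂ ∧ nbrs E K₂ v + (if p ∈ K₁ then 1 else 0) = d then 1 else 0 := by
  have e1 : K₁.filter (fun a => a ≠ p ∧ nbrs E (K₁ ∪ K₂) a = d) =
      K₁.filter (fun a => a ≠ p ∧ nbrs E K₁ a = d) :=
    filter_congr fun a ha => and_congr_right fun hap => by
      rw [nbrs_union_left hedge ha hap]
  have e2 : K₂.filter (fun b => b ≠ p ∧ nbrs E (K₁ ∪ K₂) b = d) =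
      K₂.filter (fun b => b ≠ v ∧ nbrs E K₂ b = d) ∪
      K₂.filter (fun b => b = v ∧ nbrs E K₂ v + (if p ∈ K₁ then 1 else 0) = d) := by
    ext b
    simp only [mem_union, mem_filter]
    by_cases hb : b ∈ K₂
    · have hbp : b ≠ p := fun h => hp (h ▸ hb)
      by_cases hbv : b = v
      · subst hbv
        simp [hb, hbp, nbrs_union_child hsymm hedge hpv hp hb]
      · simp [hb, hbp, hbv, nbrs_union_right hsymm hedge hb hbv]
    · simp [hb]
  have e3 : (K₂.filter (fun b => b = v ∧ nbrs E K₂ v + (if p ∈ K₁ then 1 else 0) = d)).card =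
      if v ∈ K₂ ∧ nbrs E K₂ v + (if p ∈ K₁ then 1 else 0) = d then 1 else 0 := by
    by_cases h : v ∈ K₂ ∧ nbrs E K₂ v + (if p ∈ K₁ then 1 else 0) = d
    · rw [if_pos h, card_eq_one]
      refine ⟨v, ?_⟩
      ext b
      simp only [mem_filter, mem_singleton]
      exact ⟨fun h => h.2.1, fun hb => ⟨hb ▸ h.1, hb, h.2⟩⟩
    · rw [if_neg h, card_eq_zero, filter_eq_empty_iff]
      rintro b hb ⟨rfl, hb'⟩
      exact h ⟨hb, hb'⟩
  unfold count
  rw [filter_union, card_union_of_disjoint (disjoint_filter_filter hdisj), e1, e2,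
    card_union_of_disjoint, e3, add_assoc]
  exact disjoint_filter.2 fun b _ h1 h2 => h1.1 h2.1

-- The three cases of `Merge` are: `v` deleted; `v` kept and `p` deleted; both kept. A kept `v` has
-- degree `y₂ - 1` in its own piece, so its final degree is `y₂ - 1` in the second case and `y₂` in
-- the third. This accounts for the thresholds `d + 1` and `d`.
include hdisj hsymm hedge hpv hp hv in
theorem merge_iff {y c : ℕ} :
    (Bounded E d p K₁ ∧ Bounded E d v K₂ ∧
      Merge d (mark E p K₁) (count E d p K₁) (mark E v K₂) (count E d v K₂) y c) ↔
    Bounded E d p (K₁ ∪ K₂) ∧ mark E p (K₁ ∪ K₂) = y ∧ count E d p (K₁ ∪ K₂) = c := by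
  rw [bounded_union hsymm hedge hpv hp hv, mark_union hedge hpv hp hv,
    count_union hdisj hsymm hedge hpv hp hv]
  unfold Merge mark
  by_cases hP : Bounded E d p K₁
  swap
  · simp [hP]
  by_cases hQ : Bounded E d v K₂
  swap
  · simp [hQ]
  by_cases h1 : p ∈ K₁ <;> by_cases h2 : v ∈ K₂ <;>
    simp only [hP, hQ, h1, h2, if_true, if_false, true_and, false_and, forall_const, false_imp_iff]
  · split_ifs <;> grind
  · grind
  · split_ifs <;> grind
  · grind

end

end Merge

end ForestTable

/-! ### The table of the elimination procedure and its invariant. -/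

namespace ForestTable

open Finset

/-- A table with five numerical entries in each row. -/
abbrev Table : Type := ℕ → ℕ → ℕ → ℕ → ℕ → Prop

section Step

variable (n N : ℕ) (E : ℕ → ℕ → Prop) (T : Table)

/-- The vertex `u` has not yet been eliminated. -/
def Alive (u : ℕ) : Prop := ∃ m < N, T 0 u 0 0 m

/-- The vertex `v` can be eliminated. -/
def Eligible (v : ℕ) : Prop :=
  Alive N T v ∧ ∀ p < n, ∀ q < n, Alive N T p → Alive N T q → E v p → E v q → p = q

/-- The vertex `v` is the next one to be eliminated. -/
def Selected (v : ℕ) : Prop := Eligible n N E T v ∧ ∀ w < v, ¬Eligible n N E T w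

/-- The vertex `v` is attached to `p`; here `n` is a virtual vertex, to which the last vertex
of every component is attached. -/
def Attached (v p : ℕ) : Prop :=
  (p < n ∧ Alive N T p ∧ E v p) ∨ (p = n ∧ ∀ q < n, Alive N T q → ¬E v q)

/-- The table after the elimination of one more vertex. -/
def nextTable : Table := fun d u y c m =>
  ∃ v < n, Selected n N E T v ∧
    ((u ≠ v ∧ ¬Attached n N E T v u ∧ T d u y c m) ∨
    (Attached n N E T v u ∧ ∃ y₁ < N, ∃ c₁ < N, ∃ m₁ < N, ∃ y₂ < N, ∃ c₂ < N, ∃ m₂ < N,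
      T d u y₁ c₁ m₁ ∧ T d v y₂ c₂ m₂ ∧ m = m₁ + m₂ ∧ Merge d y₁ c₁ y₂ c₂ y c))

/-- The table before the elimination of the first vertex. -/
def initTable : Table := fun d u y c m =>
  d < N ∧ c = 0 ∧ ((u = n ∧ y = 0 ∧ m = 0) ∨ (u < n ∧ ((y = 1 ∧ m = 0) ∨ (y = 0 ∧ m = 1))))

/-- The vertices that have been merged into `u`. -/
def piece (ρ : ℕ → ℕ) (u : ℕ) : Finset ℕ := (range n).filter fun v => ρ v = u

/-- The meaning of the rows of the table when `A` is the set of vertices that have not been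
eliminated, and every vertex `v` has been merged into `ρ v`. -/
def meaning (A : Finset ℕ) (ρ : ℕ → ℕ) : Table := fun d u y c m =>
  d < N ∧ (u ∈ A ∨ u = n) ∧ ∃ K ⊆ piece n ρ u, Bounded E d u K ∧ mark E u K = y ∧
    count E d u K = c ∧ K.card + m = (piece n ρ u).card

/-- Invariants of the elimination. -/
structure Stage (A : Finset ℕ) (ρ : ℕ → ℕ) : Prop where
  subset : A ⊆ range n
  root : ∀ v < n, ρ v ∈ A ∨ ρ v = n
  fix : ∀ u ∈ A, ρ u = u
  edge : ∀ a b, E a b → ρ a = ρ b ∨ (a ∈ A ∧ b ∈ A)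

variable {n N E T} {A : Finset ℕ} {ρ : ℕ → ℕ}

theorem mark_le (hE : ∀ a, ¬E a a) {K : Finset ℕ} (u : ℕ) : mark E u K ≤ K.card := by
  classical
  unfold mark
  split_ifs with h
  · refine Nat.succ_le_of_lt (card_lt_card (filter_ssubset.2 ⟨u, h, hE u⟩))
  · omega

theorem card_piece_le (u : ℕ) : (piece n ρ u).card ≤ n :=
  (card_filter_le _ _).trans (by simp)

/-- Thanks to these bounds the quantifiers in `nextTable` may be restricted to values below `N`
without losing rows. -/
theorem meaning_bounds (hE : ∀ a, ¬E a a) {d u y c m : ℕ} (h : meaning n N E A ρ d u y c m) :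
    d < N ∧ y ≤ n ∧ c ≤ n ∧ m ≤ n := by
  obtain ⟨hd, -, K, hK, -, rfl, rfl, hm⟩ := h
  have h1 := card_piece_le (n := n) (ρ := ρ) u
  have h2 : count E d u K ≤ K.card := card_filter_le _ _
  have h3 := mark_le hE (K := K) u
  omega

/-- Deleting a whole piece is always allowed and gives a row with `d = y = c = 0`, so the table
itself records which vertices survive. The virtual vertex passes this test as well. -/
theorem alive_iff (hN : n < N) (hT : ∀ d u y c m, T d u y c m ↔ meaning n N E A ρ d u y c m)
    {u : ℕ} : Alive N T u ↔ u ∈ A ∨ u = n := by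
  unfold Alive
  simp only [hT]
  constructor
  · rintro ⟨m, -, -, h, -⟩
    exact h
  · intro h
    have h1 := card_piece_le (n := n) (ρ := ρ) u
    exact ⟨(piece n ρ u).card, by omega, by omega, h, ∅, by simp, by simp [Bounded],
      by simp [mark], by simp [count], by simp⟩

/-- Initially the pieces are singletons, whose vertex is kept with degree `0` or deleted, and the
piece of the virtual vertex is empty. -/
theorem meaning_initTable (hE : ∀ a, ¬E a a) {d u y c m : ℕ} :
    initTable n N d u y c m ↔ meaning n N E (range n) id d u y c m := by
  unfold initTable meaning
  refine and_congr_right fun _ => ?_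
  have hn : piece n id n = ∅ := by
    ext a; simp +contextual [piece]
  have hu : u < n → piece n id u = {u} := fun hu => by
    ext a; simp [piece, hu]
  have hc : ∀ K ⊆ ({u} : Finset ℕ), count E d u K = 0 ∧ Bounded E d u K := fun K hK => by
    refine ⟨?_, fun v hv hvu => absurd (mem_singleton.1 (hK hv)) hvu⟩
    rw [count, card_eq_zero, filter_eq_empty_iff]
    exact fun v hv h => h.1 (mem_singleton.1 (hK hv))
  constructor
  · rintro ⟨rfl, ⟨rfl, rfl, rfl⟩ | ⟨hun, h⟩⟩
    · refine ⟨Or.inr rfl, ∅, by simp, (hc _ (by simp)).2, by simp [mark], (hc _ (by simp)).1,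
        by simp [hn]⟩
    · refine ⟨Or.inl (by simpa using hun), ?_⟩
      rw [hu hun]
      rcases h with ⟨rfl, rfl⟩ | ⟨rfl, rfl⟩
      · refine ⟨{u}, by simp, (hc _ (by simp)).2, ?_, (hc _ (by simp)).1, by simp⟩
        simp [mark, nbrs, filter_singleton, hE]
      · exact ⟨∅, by simp, (hc _ (by simp)).2, by simp [mark], (hc _ (by simp)).1, by simp⟩
  · rintro ⟨h | rfl, K, hK, -, rfl, rfl, hm⟩
    · have hun : u < n := by simpa using h
      rw [hu hun] at hK hm
      refine ⟨(hc K hK).1, Or.inr ⟨hun, ?_⟩⟩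
      rcases subset_singleton_iff.1 hK with rfl | rfl
      · right; simpa [mark] using hm
      · left; simpa [mark, nbrs, filter_singleton, hE] using hm
    · rw [hn] at hK hm
      obtain rfl := subset_empty.1 hK
      exact ⟨by simp [count], Or.inl ⟨rfl, by simp [mark], by simpa using hm⟩⟩


/-- Elimination of the vertex `v`, which is attached to `p`. -/
theorem stage_eliminate (hS : Stage n E A ρ) (hsymm : ∀ a b, E a b → E b a)
    (hE : ∀ a, ¬E a a) {v p : ℕ} (hv : v ∈ A)
    (hp : (p ∈ A ∧ E v p) ∨ p = n) (hpu : ∀ q ∈ A, E v q → q = p) :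
    Stage n E (A.erase v) (fun w => if ρ w = v then p else ρ w) := by
  have hvn : v < n := by simpa using hS.subset hv
  have hpv : p ≠ v := by
    rintro rfl
    rcases hp with hp | rfl
    · exact hE _ hp.2
    · omega
  refine ⟨(erase_subset _ _).trans hS.subset, fun w hw => ?_, fun u hu => ?_, fun a b hab => ?_⟩
  · split_ifs with h
    · exact hp.imp (fun h => mem_erase.2 ⟨hpv, h.1⟩) id
    · exact (hS.root w hw).imp (fun h' => mem_erase.2 ⟨h, h'⟩) id
  · obtain ⟨h1, h2⟩ := mem_erase.1 hu
    rw [hS.fix u h2, if_neg h1]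
  · rcases hS.edge a b hab with h | ⟨ha, hb⟩
    · exact Or.inl (by rw [h])
    · rw [hS.fix a ha, hS.fix b hb]
      -- If one end of a surviving edge is `v`, the other end is its only surviving neighbour `p`,
      -- and the edge becomes internal to the piece of `p`.
      by_cases h1 : a = v
      · subst h1
        have hbp := hpu b hb hab
        subst hbp
        left
        rw [if_pos rfl, if_neg hpv]
      · by_cases h2 : b = v
        · subst h2
          have hap := hpu a ha (hsymm _ _ hab)
          subst hap
          left
          rw [if_neg hpv, if_pos rfl]
        · exact Or.inr ⟨mem_erase.2 ⟨h1, ha⟩, mem_erase.2 ⟨h2, hb⟩⟩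

theorem piece_eliminate_of_ne {v p u : ℕ} (hu : u ≠ p) (huv : u ≠ v) :
    piece n (fun w => if ρ w = v then p else ρ w) u = piece n ρ u := by
  refine filter_congr fun w _ => ?_
  dsimp only
  split_ifs with h
  · exact ⟨fun h' => absurd h'.symm hu, fun h' => absurd (h'.symm.trans h) huv⟩
  · rfl

theorem piece_eliminate {v p : ℕ} :
    piece n (fun w => if ρ w = v then p else ρ w) p = piece n ρ p ∪ piece n ρ v := by
  unfold piece
  rw [← filter_or]
  refine filter_congr fun w _ => ?_
  dsimp only
  split_ifs with h <;> simp [h]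

/-- The rows of the table for the vertex `p`, when `v` is merged into `p`. -/
theorem meaning_merge (hS : Stage n E A ρ) (hsymm : ∀ a b, E a b → E b a)
    (hE : ∀ a, ¬E a a) {v p : ℕ} (hv : v ∈ A) (hp : (p ∈ A ∧ E v p) ∨ p = n) {d y c m : ℕ} :
    meaning n N E (A.erase v) (fun w => if ρ w = v then p else ρ w) d p y c m ↔
    ∃ y₁ c₁ m₁ y₂ c₂ m₂, meaning n N E A ρ d p y₁ c₁ m₁ ∧ meaning n N E A ρ d v y₂ c₂ m₂ ∧
      m = m₁ + m₂ ∧ Merge d y₁ c₁ y₂ c₂ y c := by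
  have hvn : v < n := by simpa using hS.subset hv
  have hpv : p ≠ v := by
    rintro rfl
    rcases hp with hp | rfl
    · exact hE _ hp.2
    · omega
  have hdis : Disjoint (piece n ρ p) (piece n ρ v) :=
    disjoint_filter.2 fun w _ h1 h2 => hpv (h1.symm.trans h2)
  have hcard := card_union_of_disjoint hdis
  have key : ∀ K₁ ⊆ piece n ρ p, ∀ K₂ ⊆ piece n ρ v,
      ((Bounded E d p K₁ ∧ Bounded E d v K₂ ∧
        Merge d (mark E p K₁) (count E d p K₁) (mark E v K₂) (count E d v K₂) y c) ↔
      Bounded E d p (K₁ ∪ K₂) ∧ mark E p (K₁ ∪ K₂) = y ∧ count E d p (K₁ ∪ K₂) = c) := by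
    intro K₁ h1 K₂ h2
    have hρ1 : ∀ a ∈ K₁, ρ a = p := fun a ha => (mem_filter.1 (h1 ha)).2
    have hρ2 : ∀ a ∈ K₂, ρ a = v := fun a ha => (mem_filter.1 (h2 ha)).2
    have hnp : p ∈ K₁ → p < n := fun h => by simpa using (mem_filter.1 (h1 h)).1
    -- An edge between different pieces joins surviving vertices, and these are the roots of their
    -- pieces.
    refine merge_iff (hdis.mono h1 h2) hsymm (fun a ha b hb hab => ?_) (fun h => ?_)
      (fun h => ?_) (fun h => ?_)
    · rcases hS.edge a b hab with h | ⟨h3, h4⟩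
      · exact absurd ((hρ1 a ha).symm.trans (h.trans (hρ2 b hb))) hpv
      · exact ⟨(hS.fix a h3).symm.trans (hρ1 a ha), (hS.fix b h4).symm.trans (hρ2 b hb)⟩
    · rcases hp with hp | rfl
      · exact hsymm _ _ hp.2
      · exact absurd (hnp h) (lt_irrefl _)
    · have hpA : p ∈ A := by
        rcases hp with hp | rfl
        · exact hp.1
        · exact absurd (by simpa using (mem_filter.1 (h2 h)).1) (lt_irrefl p)
      exact hpv ((hS.fix p hpA).symm.trans (hρ2 p h))
    · exact hpv ((hρ1 v h).symm.trans (hS.fix v hv))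
  unfold meaning
  rw [piece_eliminate]
  constructor
  · rintro ⟨hd, -, K, hK, hK1, hK2, hK3, hm⟩
    -- A kept set of the union splits uniquely along the two pieces, and this fixes all the data of
    -- both parts.
    have hKe : K ∩ piece n ρ p ∪ K ∩ piece n ρ v = K := by
      rw [← inter_union_distrib_left, inter_eq_left.2 hK]
    have hk := key (K ∩ piece n ρ p) inter_subset_right (K ∩ piece n ρ v) inter_subset_right
    rw [hKe] at hk
    obtain ⟨hb1, hb2, hM⟩ := hk.2 ⟨hK1, hK2, hK3⟩
    have hc1 : (K ∩ piece n ρ p).card ≤ (piece n ρ p).card := card_le_card inter_subset_right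
    have hc2 : (K ∩ piece n ρ v).card ≤ (piece n ρ v).card := card_le_card inter_subset_right
    have hc : K.card = (K ∩ piece n ρ p).card + (K ∩ piece n ρ v).card := by
      rw [← card_union_of_disjoint (hdis.mono inter_subset_right inter_subset_right), hKe]
    refine ⟨_, _, (piece n ρ p).card - (K ∩ piece n ρ p).card, _, _,
      (piece n ρ v).card - (K ∩ piece n ρ v).card,
      ⟨hd, hp.imp And.left id, _, inter_subset_right, hb1, rfl, rfl, by omega⟩,
      ⟨hd, Or.inl hv, _, inter_subset_right, hb2, rfl, rfl, by omega⟩, by omega, hM⟩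
  · rintro ⟨_, _, m₁, _, _, m₂, ⟨hd, -, K₁, h1, hb1, rfl, rfl, hm1⟩,
      ⟨-, -, K₂, h2, hb2, rfl, rfl, hm2⟩, rfl, hM⟩
    refine ⟨hd, hp.imp (fun h => mem_erase.2 ⟨hpv, h.1⟩) id, K₁ ∪ K₂, union_subset_union h1 h2, ?_⟩
    obtain ⟨h3, h4, h5⟩ := (key K₁ h1 K₂ h2).1 ⟨hb1, hb2, hM⟩
    refine ⟨h3, h4, h5, ?_⟩
    rw [card_union_of_disjoint (hdis.mono h1 h2)]
    omega

/-- One step of the elimination. -/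
theorem exists_meaning_nextTable (hS : Stage n E A ρ) (hsymm : ∀ a b, E a b → E b a)
    (hE : ∀ a, ¬E a a) (hN : n < N)
    (hT : ∀ d u y c m, T d u y c m ↔ meaning n N E A ρ d u y c m)
    (hA : ∃ v ∈ A, ∀ p ∈ A, ∀ q ∈ A, E v p → E v q → p = q) :
    ∃ A' ρ', Stage n E A' ρ' ∧ A'.card + 1 = A.card ∧
      ∀ d u y c m, nextTable n N E T d u y c m ↔ meaning n N E A' ρ' d u y c m := by
  classical
  have hal : ∀ {u}, u < n → (Alive N T u ↔ u ∈ A) := fun {u} hu => by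
    rw [alive_iff hN hT]
    exact or_iff_left hu.ne
  have hAn : ∀ {u}, u ∈ A → u < n := fun hu => by simpa using hS.subset hu
  have hel : ∀ {v}, v < n → (Eligible n N E T v ↔
      v ∈ A ∧ ∀ p ∈ A, ∀ q ∈ A, E v p → E v q → p = q) := fun {v} hv => by
    unfold Eligible
    rw [hal hv]
    refine and_congr_right fun _ => ⟨fun h p hp q hq => ?_, fun h p hp q hq h1 h2 => ?_⟩
    · exact h p (hAn hp) q (hAn hq) ((hal (hAn hp)).2 hp) ((hal (hAn hq)).2 hq)
    · exact h p ((hal hp).1 h1) q ((hal hq).1 h2)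
  have hex : ∃ v, Eligible n N E T v := by
    obtain ⟨v, hv, h⟩ := hA
    exact ⟨v, (hel (hAn hv)).2 ⟨hv, h⟩⟩
  -- Taking the least eligible vertex makes the existential over `v` in `nextTable` range over a
  -- single vertex.
  set v := Nat.find hex with hvdef
  have hvn : v < n := by
    obtain ⟨w, hw, h⟩ := hA
    exact lt_of_le_of_lt (Nat.find_min' hex ((hel (hAn hw)).2 ⟨hw, h⟩)) (hAn hw)
  have hsel : ∀ w, Selected n N E T w ↔ w = v := fun w => by
    rw [hvdef, eq_comm, Nat.find_eq_iff]
    rfl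
  obtain ⟨hvA, hvu⟩ := (hel hvn).1 (Nat.find_spec hex)
  obtain ⟨p, hp, hpu⟩ : ∃ p, ((p ∈ A ∧ E v p) ∨ p = n) ∧ ∀ u, Attached n N E T v u ↔ u = p := by
    by_cases h : ∃ p ∈ A, E v p
    · obtain ⟨p, hp, hvp⟩ := h
      refine ⟨p, Or.inl ⟨hp, hvp⟩, fun u => ⟨?_, ?_⟩⟩
      · rintro (⟨h1, h2, h3⟩ | ⟨rfl, h⟩)
        · exact hvu _ ((hal h1).1 h2) _ hp h3 hvp
        · exact absurd hvp (h p (hAn hp) ((hal (hAn hp)).2 hp))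
      · rintro rfl
        exact Or.inl ⟨hAn hp, (hal (hAn hp)).2 hp, hvp⟩
    · push Not at h
      refine ⟨n, Or.inr rfl, fun u => ⟨?_, ?_⟩⟩
      · rintro (⟨h1, h2, h3⟩ | ⟨rfl, -⟩)
        · exact absurd h3 (h u ((hal h1).1 h2))
        · rfl
      · rintro rfl
        exact Or.inr ⟨rfl, fun q hq h1 => h q ((hal hq).1 h1)⟩
  have hpu' : ∀ q ∈ A, E v q → q = p := fun q hq hvq =>
    (hpu q).1 (Or.inl ⟨hAn hq, (hal (hAn hq)).2 hq, hvq⟩)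
  have hpv : p ≠ v := by
    rintro h
    rcases hp with hp | hp
    · exact hE v (h ▸ hp.2)
    · omega
  refine ⟨_, _, stage_eliminate hS hsymm hE hvA hp hpu', card_erase_add_one hvA,
    fun d u y c m => ?_⟩
  have hnext : nextTable n N E T d u y c m ↔ (u ≠ v ∧ u ≠ p ∧ T d u y c m) ∨
      (u = p ∧ ∃ y₁ c₁ m₁ y₂ c₂ m₂, T d u y₁ c₁ m₁ ∧ T d v y₂ c₂ m₂ ∧
        m = m₁ + m₂ ∧ Merge d y₁ c₁ y₂ c₂ y c) := by
    unfold nextTable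
    constructor
    · rintro ⟨w, -, hw, h⟩
      obtain rfl := (hsel w).1 hw
      rw [hpu] at h
      refine h.imp id ?_
      rintro ⟨h1, y₁, -, c₁, -, m₁, -, y₂, -, c₂, -, m₂, -, h⟩
      exact ⟨h1, y₁, c₁, m₁, y₂, c₂, m₂, h⟩
    · intro h
      refine ⟨v, hvn, (hsel v).2 rfl, ?_⟩
      rw [hpu]
      refine h.imp id ?_
      rintro ⟨h1, y₁, c₁, m₁, y₂, c₂, m₂, h2, h3, h⟩
      have b1 := meaning_bounds hE ((hT _ _ _ _ _).1 h2)
      have b2 := meaning_bounds hE ((hT _ _ _ _ _).1 h3)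
      exact ⟨h1, y₁, by omega, c₁, by omega, m₁, by omega, y₂, by omega, c₂, by omega, m₂,
        by omega, h2, h3, h⟩
  rw [hnext]
  simp only [hT]
  by_cases hup : u = p
  · subst hup
    rw [meaning_merge hS hsymm hE hvA hp]
    simp
  · simp only [hup, false_and, or_false, ne_eq, not_false_eq_true, true_and]
    -- The eliminated vertex has no rows left on either side.
    by_cases huv : u = v
    · have : v ≠ n := hvn.ne
      simp [huv, meaning, this]
    · unfold meaning
      rw [piece_eliminate_of_ne hup huv]
      simp [huv]

/-- The table after the elimination of all vertices. -/
theorem iterate_nextTable (hsymm : ∀ a b, E a b → E b a) (hE : ∀ a, ¬E a a)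
    (hEn : ∀ a b, E a b → a < n ∧ b < n) (hN : n < N)
    (hfor : ∀ A ⊆ range n, A.Nonempty → ∃ v ∈ A, ∀ p ∈ A, ∀ q ∈ A, E v p → E v q → p = q)
    {d y c m : ℕ} :
    (nextTable n N E)^[n] (initTable n N) d n y c m ↔ d < N ∧ ∃ K ⊆ range n,
      (∀ v ∈ K, nbrs E K v ≤ d) ∧ y = 0 ∧ (K.filter fun v => nbrs E K v = d).card = c ∧
      K.card + m = n := by
  have key : ∀ t ≤ n, ∃ A ρ, Stage n E A ρ ∧ A.card + t = n ∧ ∀ d u y c m,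
      (nextTable n N E)^[t] (initTable n N) d u y c m ↔ meaning n N E A ρ d u y c m := by
    intro t
    induction t with
    | zero =>
      refine fun _ => ⟨range n, id, ⟨subset_rfl, fun v hv => Or.inl (by simpa using hv),
        fun u _ => rfl, fun a b hab => Or.inr ?_⟩, by simp,
        fun d u y c m => meaning_initTable hE⟩
      simpa using hEn a b hab
    | succ t ih =>
      intro ht
      obtain ⟨A, ρ, hS, hA, hT⟩ := ih (by omega)
      obtain ⟨A', ρ', hS', hA', hT'⟩ := exists_meaning_nextTable hS hsymm hE hN hT
        (hfor A hS.subset (card_pos.1 (by omega)))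
      refine ⟨A', ρ', hS', by omega, fun d u y c m => ?_⟩
      rw [Function.iterate_succ_apply', hT']
  obtain ⟨A, ρ, hS, hA, hT⟩ := key n le_rfl
  -- No vertex survives `n` rounds, so every one has been merged into the virtual vertex.
  obtain rfl : A = ∅ := card_eq_zero.1 (by omega)
  have hpiece : piece n ρ n = range n :=
    filter_true_of_mem fun v hv => (hS.root v (by simpa using hv)).resolve_left (by simp)
  rw [hT]
  unfold meaning
  rw [hpiece]
  simp only [or_true, true_and, card_range]
  refine and_congr_right fun _ => exists_congr fun K => and_congr_right fun hK => ?_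
  -- The virtual root is not a vertex, so the exemption of the root is void: all degrees are bounded
  -- and all vertices are counted.
  have hnK : n ∉ K := fun h => by simpa using hK h
  have hne : ∀ v ∈ K, v ≠ n := fun v hv h => hnK (h ▸ hv)
  have h1 : Bounded E d n K ↔ ∀ v ∈ K, nbrs E K v ≤ d :=
    forall₂_congr fun v hv => by simp [hne v hv]
  have h2 : count E d n K = (K.filter fun v => nbrs E K v = d).card :=
    congrArg card (filter_congr fun v hv => by simp [hne v hv])
  rw [h1, h2, mark, if_neg hnK, eq_comm (a := 0)]

end Step

end ForestTable

/-! ### Forests, equating sets and the final table. -/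

namespace ForestTable

open Finset

/-- A nonempty finite forest has a vertex with at most one neighbour. -/
theorem _root_.SimpleGraph.IsAcyclic.exists_forall_adj_eq {V : Type*} [Finite V] [Nonempty V]
    {G : SimpleGraph V} (hG : G.IsAcyclic) :
    ∃ v, ∀ p q, G.Adj v p → G.Adj v q → p = q := by
  obtain ⟨u, v, p, hp, hmax⟩ := SimpleGraph.Walk.exists_isPath_forall_isPath_length_le_length G
  -- At the end of a longest path, a neighbour off the path would prolong it, and a neighbour on the
  -- path is the second vertex by acyclicity.
  have key : ∀ w, G.Adj u w → w = p.snd := fun w hw => by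
    refine hG.eq_snd_of_adj_start hp hw ?_
    by_contra hs
    have := hmax w v (.cons hw.symm p) (hp.cons hs)
    simp at this
  exact ⟨u, fun a b ha hb => (key a ha).trans (key b hb).symm⟩

variable {n : ℕ} (G : SimpleGraph (Fin n))

/-- The adjacency relation of a graph on `{0, …, n - 1}`, as a relation between numbers. -/
def natAdj (a b : ℕ) : Prop := ∃ (ha : a < n) (hb : b < n), G.Adj ⟨a, ha⟩ ⟨b, hb⟩

variable {G}

theorem natAdj_symm (a b : ℕ) : natAdj G a b → natAdj G b a :=
  fun ⟨ha, hb, h⟩ => ⟨hb, ha, h.symm⟩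

theorem natAdj_irrefl (a : ℕ) : ¬natAdj G a a := fun ⟨_, _, h⟩ => G.loopless.irrefl _ h

theorem natAdj_val (a b : Fin n) : natAdj G a b ↔ G.Adj a b :=
  ⟨fun ⟨_, _, h⟩ => h, fun h => ⟨a.2, b.2, h⟩⟩

/-- Induced subgraphs of forests are forests; therefore the elimination never gets stuck. -/
theorem exists_natAdj_unique (hG : G.IsAcyclic) (A : Finset ℕ) (hA : A ⊆ range n)
    (hne : A.Nonempty) :
    ∃ v ∈ A, ∀ p ∈ A, ∀ q ∈ A, natAdj G v p → natAdj G v q → p = q := by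
  obtain ⟨a, ha⟩ := hne
  have : Nonempty {x : Fin n | x.1 ∈ A} := ⟨⟨⟨a, by simpa using hA ha⟩, ha⟩⟩
  obtain ⟨v, hv⟩ := (hG.induce {x : Fin n | x.1 ∈ A}).exists_forall_adj_eq
  refine ⟨v.1.1, v.2, ?_⟩
  rintro p hp q hq ⟨_, hpn, h1⟩ ⟨_, hqn, h2⟩
  have := hv ⟨⟨p, hpn⟩, hp⟩ ⟨⟨q, hqn⟩, hq⟩ h1 h2
  simpa using this

/-- As `k ≥ 1`, the bound `d` is attained by some vertex and so is the maximum degree. This lets the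
dynamic programme fix `d` in advance. -/
theorem le_numMaxDegree_iff {V : Type*} (_ : Fintype V) (H : SimpleGraph V) {k : ℕ} (hk : 1 ≤ k) :
    k ≤ numMaxDegree H ↔ ∃ d, (∀ v, (H.neighborSet v).ncard ≤ d) ∧
      k ≤ {v | (H.neighborSet v).ncard = d}.ncard := by
  classical
  have hdeg : ∀ v, (H.neighborSet v).ncard = H.degree v := fun v => by
    rw [Set.ncard_eq_toFinset_card']; rfl
  have hnum : numMaxDegree H = {v | (H.neighborSet v).ncard = H.maxDegree}.ncard := by
    simp only [hdeg]
    rw [Set.ncard_eq_toFinset_card', numMaxDegree]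
    congr 1
    ext v
    simp only [mem_filter, mem_univ, true_and, Set.mem_toFinset, Set.mem_ofPred_eq]
  rw [hnum]
  constructor
  · intro h
    exact ⟨_, fun v => (hdeg v).trans_le (H.degree_le_maxDegree v), h⟩
  · rintro ⟨d, h1, h2⟩
    have hne : {v | (H.neighborSet v).ncard = d}.Nonempty :=
      (Set.ncard_pos (Set.toFinite _)).1 (by omega)
    obtain ⟨v, hv⟩ := hne
    have : H.maxDegree = d := by
      refine le_antisymm (H.maxDegree_le_of_forall_degree_le d fun w => hdeg w ▸ h1 w) ?_
      rw [← hv.out, hdeg]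
      exact H.degree_le_maxDegree v
    rwa [this]

/-- Transport along the injection of the vertices outside `X` into `ℕ`, whose image is `K`. -/
theorem isEquatingSet_iff {k : ℕ} (hk : 1 ≤ k) (X : Finset (Fin n)) {K : Finset ℕ}
    (hKn : K ⊆ range n) (hK : ∀ v : Fin n, v.1 ∈ K ↔ v ∉ X) :
    IsEquatingSet k G X ↔ (∃ d, (∀ v ∈ K, nbrs (natAdj G) K v ≤ d) ∧
      k ≤ (K.filter fun v => nbrs (natAdj G) K v = d).card) ∨ K.card < k := by
  classical
  have hinj : Function.Injective (fun x : {v : Fin n | v ∉ X} => x.1.1) :=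
    Fin.val_injective.comp Subtype.val_injective
  have hn : ∀ x : {v : Fin n | v ∉ X}, ((G.induce {v : Fin n | v ∉ X}).neighborSet x).ncard =
      nbrs (natAdj G) K x.1.1 := fun x => by
    rw [nbrs, ← Set.ncard_coe_finset, ← Set.ncard_image_of_injective _ hinj]
    congr 1
    ext b
    simp only [Set.mem_image, SimpleGraph.mem_neighborSet, SimpleGraph.comap_adj, coe_filter,
      Set.mem_ofPred_eq]
    constructor
    · rintro ⟨y, hy, rfl⟩
      exact ⟨(hK y.1).2 y.2, (natAdj_val _ _).2 hy⟩
    · rintro ⟨hb, _, hbn, h⟩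
      exact ⟨⟨⟨b, hbn⟩, (hK ⟨b, hbn⟩).1 hb⟩, h, rfl⟩
  have hc : ∀ d, {x | ((G.induce {v : Fin n | v ∉ X}).neighborSet x).ncard = d}.ncard =
      (K.filter fun v => nbrs (natAdj G) K v = d).card := fun d => by
    simp only [hn]
    rw [← Set.ncard_coe_finset, ← Set.ncard_image_of_injective _ hinj]
    congr 1
    ext b
    simp only [Set.mem_image, coe_filter, Set.mem_ofPred_eq]
    constructor
    · rintro ⟨y, hy, rfl⟩
      exact ⟨(hK y.1).2 y.2, hy⟩
    · rintro ⟨hb, h⟩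
      have hbn : b < n := by simpa using hKn hb
      exact ⟨⟨⟨b, hbn⟩, (hK ⟨b, hbn⟩).1 hb⟩, h, rfl⟩
  have hcard : Fintype.card {v : Fin n // v ∉ X} = K.card := by
    rw [← Set.ncard_coe_finset, ← Nat.card_eq_fintype_card, ← Set.ncard_univ,
      ← Set.ncard_image_of_injective _ hinj]
    congr 1
    ext b
    simp only [Set.mem_image, Set.mem_univ, true_and, mem_coe]
    constructor
    · rintro ⟨y, rfl⟩
      exact (hK y.1).2 y.2
    · intro hb
      have hbn : b < n := by simpa using hKn hb
      exact ⟨⟨⟨b, hbn⟩, (hK ⟨b, hbn⟩).1 hb⟩, rfl⟩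
  unfold IsEquatingSet
  refine or_congr ((le_numMaxDegree_iff _ _ hk).trans
    (exists_congr fun d => and_congr ?_ (by rw [hc]))) ?_
  · constructor
    · intro h v hv
      have hvn : v < n := by simpa using hKn hv
      exact hn ⟨⟨v, hvn⟩, (hK ⟨v, hvn⟩).1 hv⟩ ▸ h ⟨⟨v, hvn⟩, (hK ⟨v, hvn⟩).1 hv⟩
    · intro h x
      rw [hn]
      exact h _ ((hK x.1).2 x.2)
  · rw [← hcard]
    constructor <;> intro h <;> convert h

/-- Deleting some `m` vertices achieves the desired property, in terms of the final table `T`. -/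
def Good (k n N : ℕ) (T : Table) (m : ℕ) : Prop :=
  n < k + m ∨ ∃ d < N, ∃ c < N, k ≤ c ∧ T d n 0 c m

theorem isLeast_good {k N : ℕ} (hk : 1 ≤ k) (hN : n < N) (hG : G.IsAcyclic) :
    IsLeast {m | Good k n N ((nextTable n N (natAdj G))^[n] (initTable n N)) m}
      (equatingNumber k G) := by
  classical
  have htab : ∀ {d y c m}, _ := fun {d y c m} => iterate_nextTable (N := N) (d := d) (y := y)
    (c := c) (m := m) natAdj_symm natAdj_irrefl
    (fun a b (h : natAdj G a b) => ⟨h.1, h.2.1⟩) hN (exists_natAdj_unique hG)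
  have hle : ∀ X : Finset (Fin n), IsEquatingSet k G X → equatingNumber k G ≤ X.card :=
    fun X hX => Nat.sInf_le ⟨X, hX, rfl⟩
  constructor
  · obtain ⟨X, hX, hXm⟩ := exists_card_eq_equatingNumber k hk G
    have hmem : ∀ v : Fin n, v.1 ∈ (Xᶜ).image Fin.val ↔ v ∉ X := fun v => by
      simp [Fin.val_inj]
    have hsub : (Xᶜ).image Fin.val ⊆ range n := fun v hv => by
      obtain ⟨w, -, rfl⟩ := mem_image.1 hv
      simp
    have hcard : ((Xᶜ).image Fin.val).card + X.card = n := by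
      rw [card_image_of_injective _ Fin.val_injective, card_compl_add_card, Fintype.card_fin]
    rw [isEquatingSet_iff hk X hsub hmem] at hX
    set K := (Xᶜ).image Fin.val
    rw [← hXm]
    rcases hX with ⟨d, h1, h2⟩ | h
    · obtain ⟨v, hv⟩ : (K.filter fun v => nbrs (natAdj G) K v = d).Nonempty :=
        card_pos.1 (by omega)
      -- The degree `d` is attained inside `K`, so it is at most `n` and fits into the table.
      have hd : d ≤ K.card := (mem_filter.1 hv).2 ▸ card_filter_le _ _
      have hc : (K.filter fun v => nbrs (natAdj G) K v = d).card ≤ K.card := card_filter_le _ _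
      exact Or.inr ⟨d, by omega, _, by omega, h2, htab.2 ⟨by omega, K, hsub, h1, rfl, rfl, hcard⟩⟩
    · exact Or.inl (by omega)
  · rintro m (h | ⟨d, hd, c, hc, hkc, h⟩)
    · by_cases hm : m ≤ n
      · obtain ⟨X, -, hX⟩ := exists_subset_card_eq (s := (univ : Finset (Fin n))) (n := m)
          (by simpa using hm)
        rw [← hX]
        refine hle X (Or.inr ?_)
        have : (Xᶜ).card < k := by rw [card_compl, Fintype.card_fin]; omega
        convert this
        rw [Fintype.card_subtype]
        congr 1
        ext v
        simp
      -- For `m > n` no set has `m` elements, but deleting all vertices shows that the minimum is at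
      -- most `n`.
      · refine (hle univ (Or.inr ?_)).trans (by simp; omega)
        simpa using (by omega : 0 < k)
    · obtain ⟨-, K, hK, h1, -, h2, h3⟩ := htab.1 h
      have hX : (univ.filter fun v : Fin n => v.1 ∉ K).card = m := by
        have e : ((univ.filter fun v : Fin n => v.1 ∈ K).image Fin.val) = K := by
          ext b
          simp only [mem_image, mem_filter, mem_univ, true_and]
          constructor
          · rintro ⟨v, hv, rfl⟩; exact hv
          · intro hb
            exact ⟨⟨b, by simpa using hK hb⟩, hb, rfl⟩
        have e2 := congrArg card e
        rw [card_image_of_injective _ Fin.val_injective] at e2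
        have e3 := card_filter_add_card_filter_not (s := (univ : Finset (Fin n)))
          (fun v : Fin n => v.1 ∈ K)
        rw [card_univ, Fintype.card_fin] at e3
        omega
      rw [← hX]
      refine hle _ ((isEquatingSet_iff hk _ hK (by simp)).2 (Or.inl ⟨d, h1, ?_⟩))
      omega

end ForestTable

/-! ### The dynamic programme written as arithmetical expressions. -/

namespace StackProg

open Function

namespace Expr

section Logic

variable {τ : Bool → List Bool} {σ : ℕ → ℕ} {a b : Expr} {i : ℕ}

/-- An expression is regarded as true if its value is not `0`. -/
def Holds (τ : Bool → List Bool) (σ : ℕ → ℕ) (e : Expr) : Prop := e.eval τ σ ≠ 0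

/-- Negation. -/
def not (a : Expr) : Expr := sub (const 1) a

/-- Conjunction. -/
def and (a b : Expr) : Expr := mul a b

/-- Disjunction. -/
def or (a b : Expr) : Expr := add a b

/-- Strict inequality. -/
def lt (a b : Expr) : Expr := sub b a

/-- Equality. -/
def eq (a b : Expr) : Expr := not (or (lt a b) (lt b a))

/-- Bounded existential quantification. -/
def ex (i : ℕ) (a b : Expr) : Expr := sum i a b

/-- Bounded universal quantification. -/
def all (i : ℕ) (a b : Expr) : Expr := not (ex i a (not b))

-- Truth only means being nonzero, but a negation is exactly `0` or `1`. Sums of negations therefore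
-- count, which is how `order` and `least` produce numbers.
open Classical in
theorem eval_not : (not a).eval τ σ = if Holds τ σ a then 0 else 1 := by
  unfold Holds not
  simp only [eval]
  split_ifs <;> omega

@[simp] theorem holds_not : Holds τ σ (not a) ↔ ¬Holds τ σ a := by
  rw [Holds, eval_not]
  split_ifs with h <;> simp [h]

@[simp] theorem holds_and : Holds τ σ (and a b) ↔ Holds τ σ a ∧ Holds τ σ b := by
  simp [Holds, and, eval]

@[simp] theorem holds_or : Holds τ σ (or a b) ↔ Holds τ σ a ∨ Holds τ σ b := by
  simp only [Holds, or, eval]; omega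

@[simp] theorem holds_lt : Holds τ σ (lt a b) ↔ a.eval τ σ < b.eval τ σ := by
  simp only [Holds, lt, eval]; omega

@[simp] theorem holds_eq : Holds τ σ (eq a b) ↔ a.eval τ σ = b.eval τ σ := by
  simp only [eq, holds_not, holds_or, holds_lt]; omega

theorem holds_bit {s : Bool} :
    Holds τ σ (bit s a) ↔ (τ s).getD (a.eval τ σ) false = true := by
  simp only [Holds, eval]
  cases (τ s).getD (a.eval τ σ) false <;> simp

theorem holds_ex {n : ℕ} (ha : a.eval τ σ = n) {P : ℕ → Prop}
    (h : ∀ x < n, (Holds τ (update σ i x) b ↔ P x)) :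
    Holds τ σ (ex i a b) ↔ ∃ x < n, P x := by
  simp only [Holds, ex, eval, ne_eq, Finset.sum_eq_zero_iff, Finset.mem_range, ha]
  push Not
  exact exists_congr fun x => and_congr_right fun hx => h x hx

theorem holds_ex_var {n j : ℕ} (ha : σ j = n) {P : ℕ → Prop}
    (h : ∀ x < n, (Holds τ (update σ i x) b ↔ P x)) :
    Holds τ σ (ex i (var j) b) ↔ ∃ x < n, P x :=
  holds_ex (a := var j) ha h

theorem holds_all {n : ℕ} (ha : a.eval τ σ = n) {P : ℕ → Prop}
    (h : ∀ x < n, (Holds τ (update σ i x) b ↔ P x)) :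
    Holds τ σ (all i a b) ↔ ∀ x < n, P x := by
  rw [all, holds_not, holds_ex ha (P := fun x => ¬P x) fun x hx => by rw [holds_not, h x hx]]
  push Not
  rfl

end Logic

open ForestTable

/-- The order of the forest: the number of initial entries `true` of the input. -/
def order : Expr := sum 20 (var 0) (all 21 (add (var 20) (const 1)) (bit false (var 21)))

/-- Adjacency of the values of the variables `i` and `j`. -/
def adj (i j : ℕ) : Expr :=
  and (lt (var i) order) <| and (lt (var j) order) <|
    bit false (add (add order (const 1)) (add (mul (var i) order) (var j)))

/-- The position of a row in a table, when all entries are less than `N`. -/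
def rowCode (N d u y c m : ℕ) : ℕ := (((d * N + u) * N + y) * N + c) * N + m

theorem rowCode_lt {N d u y c m : ℕ} (hd : d < N) (hu : u < N) (hy : y < N) (hc : c < N)
    (hm : m < N) : rowCode N d u y c m < N * N * N * N * N := by
  have key : ∀ {a b M : ℕ}, a < M → b < N → a * N + b < M * N := fun {a b M} ha hb =>
    calc a * N + b < (a + 1) * N := by rw [Nat.succ_mul]; omega
      _ ≤ M * N := Nat.mul_le_mul_right N ha
  exact key (key (key (key hd hu) hy) hc) hm

/-- Uniqueness of digits in base `N`. -/
theorem rowCode_inj {N d u y c m d' u' y' c' m' : ℕ} (hu : u < N) (hy : y < N) (hc : c < N)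
    (hm : m < N) (hu' : u' < N) (hy' : y' < N) (hc' : c' < N) (hm' : m' < N)
    (h : rowCode N d u y c m = rowCode N d' u' y' c' m') :
    d = d' ∧ u = u' ∧ y = y' ∧ c = c' ∧ m = m' := by
  have key : ∀ {a b a' b' : ℕ}, b < N → b' < N → a * N + b = a' * N + b' → a = a' ∧ b = b' := by
    intro a b a' b' hb hb' h
    have h1 := congrArg (· / N) h
    have h2 := congrArg (· % N) h
    have hN : 0 < N := by omega
    simp only [Nat.mul_add_mod', Nat.mod_eq_of_lt hb, Nat.mod_eq_of_lt hb'] at h2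
    subst h2
    exact ⟨Nat.eq_of_mul_eq_mul_right hN (by omega), rfl⟩
  obtain ⟨h, h1⟩ := key hm hm' h
  obtain ⟨h, h2⟩ := key hc hc' h
  obtain ⟨h, h3⟩ := key hy hy' h
  obtain ⟨h, h4⟩ := key hu hu' h
  exact ⟨h, h4, h3, h2, h1⟩

/-- The expression for the position of a row. -/
def code (d u y c m : Expr) : Expr :=
  add (mul (add (mul (add (mul (add (mul d (var 0)) u) (var 0)) y) (var 0)) c) (var 0)) m

/-- The row with the given entries belongs to the working table. -/
def row (d u y c m : Expr) : Expr := bit true (code d u y c m)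

/-- The expression for `Alive`. -/
def alive (i : ℕ) : Expr := ex 22 (var 0) (row (const 0) (var i) (const 0) (const 0) (var 22))

/-- The expression for `Eligible`. -/
def eligible (i : ℕ) : Expr :=
  and (alive i) <| all 23 order <| all 24 order <|
    or (not (alive 23)) <| or (not (alive 24)) <| or (not (adj i 23)) <| or (not (adj i 24)) <|
      eq (var 23) (var 24)

/-- The expression for `Selected`. -/
def selected (i : ℕ) : Expr := and (eligible i) (all 25 (var i) (not (eligible 25)))

/-- The expression for `Attached`. -/
def attached (i j : ℕ) : Expr :=
  or (and (lt (var j) order) (and (alive j) (adj i j)))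
    (and (eq (var j) order) (all 26 order (or (not (alive 26)) (not (adj i 26)))))

/-- The expression for `Merge`. -/
def merge (d y₁ c₁ y₂ c₂ y c : Expr) : Expr :=
  or (and (eq y₂ (const 0)) (and (eq y y₁) (eq c (add c₁ c₂)))) <|
  or (and (lt (const 0) y₂) <| and (eq y₁ (const 0)) <| and (lt y₂ (add d (const 2))) <|
    and (eq y (const 0)) <|
      or (and (eq y₂ (add d (const 1))) (eq c (add (add c₁ c₂) (const 1))))
        (and (not (eq y₂ (add d (const 1)))) (eq c (add c₁ c₂)))) <|
  and (lt (const 0) y₂) <| and (lt (const 0) y₁) <| and (lt y₂ (add d (const 1))) <|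
    and (eq y (add y₁ (const 1))) <|
      or (and (eq y₂ d) (eq c (add (add c₁ c₂) (const 1))))
        (and (not (eq y₂ d)) (eq c (add c₁ c₂)))

/-- The expression for a table, where `e` describes the row with the entries given by the
variables `2`, …, `6`. -/
def rows (e : Expr) : Expr :=
  ex 2 (var 0) <| ex 3 (var 0) <| ex 4 (var 0) <| ex 5 (var 0) <| ex 6 (var 0) <|
    and (eq (var 1) (code (var 2) (var 3) (var 4) (var 5) (var 6))) e

/-- The expression for `initTable`. -/
def init : Expr :=
  and (eq (var 5) (const 0)) <|
    or (and (eq (var 3) order) (and (eq (var 4) (const 0)) (eq (var 6) (const 0)))) <|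
    and (lt (var 3) order) <|
      or (and (eq (var 4) (const 1)) (eq (var 6) (const 0)))
        (and (eq (var 4) (const 0)) (eq (var 6) (const 1)))

/-- The expression for `nextTable`. -/
def next : Expr :=
  ex 7 order <| and (selected 7) <|
    or (and (not (eq (var 3) (var 7))) (and (not (attached 7 3))
      (row (var 2) (var 3) (var 4) (var 5) (var 6)))) <|
    and (attached 7 3) <|
      ex 8 (var 0) <| ex 9 (var 0) <| ex 10 (var 0) <| ex 11 (var 0) <| ex 12 (var 0) <|
      ex 13 (var 0) <|
        and (row (var 2) (var 3) (var 8) (var 9) (var 10)) <|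
        and (row (var 2) (var 7) (var 11) (var 12) (var 13)) <|
        and (eq (var 6) (add (var 10) (var 13)))
          (merge (var 2) (var 8) (var 9) (var 11) (var 12) (var 4) (var 5))

/-- The expression for `Good`. -/
def good (k : ℕ) : Expr :=
  or (lt order (add (const k) (var 2))) <|
    ex 3 (var 0) <| ex 4 (var 0) <|
      and (not (lt (var 4) (const k))) (row (var 3) order (const 0) (var 4) (var 2))

/-- The expression for the number of rows of the table. -/
def size : Expr := mul (mul (mul (mul (var 0) (var 0)) (var 0)) (var 0)) (var 0)

/-- The expression for the least number of vertices to be deleted. -/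
def least (k : ℕ) : Expr := sum 1 (var 0) (not (ex 2 (add (var 1) (const 1)) (good k)))

/-- The input encodes the relation `E` on `{0, …, n - 1}`. -/
structure Encodes (w : List Bool) (n : ℕ) (E : ℕ → ℕ → Prop) : Prop where
  lt : n < w.length
  isTrue : ∀ x < n, w.getD x false = true
  isFalse : w.getD n false = false
  adj : ∀ a < n, ∀ b < n, w.getD (n + 1 + (a * n + b)) false = true ↔ E a b
  left : ∀ a b, E a b → a < n
  right : ∀ a b, E a b → b < n

/-- The list `l` contains the truth values of the table `T`. -/
def Agrees (N : ℕ) (l : List Bool) (T : Table) : Prop :=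
  ∀ d < N, ∀ u < N, ∀ y < N, ∀ c < N, ∀ m < N,
    l.getD (rowCode N d u y c m) false = true ↔ T d u y c m

section Semantics

variable {w l : List Bool} {n : ℕ} {E : ℕ → ℕ → Prop} {T : Table} {σ : ℕ → ℕ}

/-- The expression counts the `x` for which the entries `0, …, x` are all `true`. The entry `n` is
the separator `false`, so these are the `x < n`. -/
theorem eval_order (hw : Encodes w n E) (hσ : σ 0 = w.length) :
    order.eval (tables w l) σ = n := by
  classical
  have h : ∀ x, (all 21 (add (var 20) (const 1)) (bit false (var 21))).eval (tables w l)
      (update σ 20 x) = if x < n then 1 else 0 := fun x => by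
    have h : Holds (tables w l) (update σ 20 x)
        (ex 21 (add (var 20) (const 1)) (not (bit false (var 21)))) ↔
        ∃ y < x + 1, ¬w.getD y false = true :=
      holds_ex (by simp [eval]) fun y _ => by
        rw [holds_not, holds_bit]; simp [eval, tables]
    rw [all, eval_not, h]
    by_cases hx : x < n
    · rw [if_pos hx, if_neg]
      push Not
      exact fun y hy => hw.isTrue y (by omega)
    · rw [if_neg hx, if_pos ⟨n, by omega, by simpa using hw.isFalse⟩]
  simp only [order, eval, hσ, h]
  have := hw.lt
  rw [← Finset.sum_filter, Finset.sum_const, smul_eq_mul, mul_one]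
  have : (Finset.range w.length).filter (· < n) = Finset.range n := by
    ext x; simp; omega
  rw [this, Finset.card_range]

/-- The two inequalities in `adj` are essential: a column index of `n` or more would read a position
outside the intended row of the matrix. -/
theorem holds_adj (hw : Encodes w n E) (hσ : σ 0 = w.length) {i j : ℕ} :
    Holds (tables w l) σ (adj i j) ↔ E (σ i) (σ j) := by
  simp only [adj, holds_and, holds_lt, holds_bit, eval, eval_order hw hσ]
  constructor
  · rintro ⟨h1, h2, h3⟩
    exact (hw.adj _ h1 _ h2).1 h3
  · intro h
    have h1 := hw.left _ _ h
    have h2 := hw.right _ _ h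
    exact ⟨h1, h2, (hw.adj _ h1 _ h2).2 h⟩

variable (hw : Encodes w n E) (hT : Agrees w.length l T) (hσ : σ 0 = w.length)

include hT hσ

theorem holds_row {d u y c m : Expr} (hd : d.eval (tables w l) σ < w.length)
    (hu : u.eval (tables w l) σ < w.length) (hy : y.eval (tables w l) σ < w.length)
    (hc : c.eval (tables w l) σ < w.length) (hm : m.eval (tables w l) σ < w.length) :
    Holds (tables w l) σ (row d u y c m) ↔ T (d.eval (tables w l) σ) (u.eval (tables w l) σ)
      (y.eval (tables w l) σ) (c.eval (tables w l) σ) (m.eval (tables w l) σ) := by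
  rw [← hT _ hd _ hu _ hy _ hc _ hm, row, holds_bit]
  simp only [code, eval, hσ]
  rfl

/-- Variables are plain numbers, so capture must be excluded: the auxiliary formulas bind only
variables from `20` on, and are applied to variables that they do not bind. -/
theorem holds_alive {i : ℕ} (hi : i ≠ 22) (hi' : σ i < w.length) :
    Holds (tables w l) σ (alive i) ↔ Alive w.length T (σ i) := by
  refine holds_ex_var hσ fun x hx => ?_
  have h0 : 0 < w.length := by omega
  rw [holds_row hT (by simpa using hσ)] <;> simp [eval, *]

include hw

theorem holds_eligible {i : ℕ} (h1 : i ≠ 22) (h2 : i ≠ 23) (h3 : i ≠ 24)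
    (hi' : σ i < w.length) : Holds (tables w l) σ (eligible i) ↔ Eligible n w.length E T (σ i) := by
  have hn := hw.lt
  rw [eligible, holds_and, holds_alive hT hσ h1 hi']
  refine and_congr_right fun _ => holds_all (eval_order hw hσ) fun p hp =>
    holds_all (eval_order hw (by simpa using hσ)) fun q hq => ?_
  have hσ' : update (update σ 23 p) 24 q 0 = w.length := by simpa using hσ
  rw [holds_or, holds_or, holds_or, holds_or, holds_not, holds_not, holds_not, holds_not,
    holds_alive hT hσ' (by simp) (by simp; omega), holds_alive hT hσ' (by simp) (by simp; omega),
    holds_adj hw hσ', holds_adj hw hσ', holds_eq]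
  simp only [eval, update_apply, h2, h3]
  simp
  tauto

theorem holds_selected {i : ℕ} (h1 : i < 22) (hi' : σ i < w.length) :
    Holds (tables w l) σ (selected i) ↔ Selected n w.length E T (σ i) := by
  rw [selected, holds_and, holds_eligible hw hT hσ (by omega) (by omega) (by omega) hi']
  refine and_congr_right fun _ => holds_all rfl fun x hx => ?_
  have hx' : x < σ i := hx
  rw [holds_not, holds_eligible hw hT (by simpa using hσ) (by simp) (by simp) (by simp)
    (by simp; omega), update_self]

theorem holds_attached {i j : ℕ} (h1 : i < 22) (h2 : j < 22) (hj' : σ j < w.length) :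
    Holds (tables w l) σ (attached i j) ↔ Attached n w.length E T (σ i) (σ j) := by
  have hn := hw.lt
  have h3 : i ≠ 26 := by omega
  rw [attached, holds_or, holds_and, holds_and, holds_and, holds_lt, holds_eq, eval_order hw hσ,
    holds_alive hT hσ (by omega) hj', holds_adj hw hσ]
  refine or_congr Iff.rfl (and_congr Iff.rfl ((holds_all (eval_order hw hσ) fun q hq => ?_)))
  have hσ' : update σ 26 q 0 = w.length := by simpa using hσ
  rw [holds_or, holds_not, holds_not, holds_alive hT hσ' (by simp) (by simp; omega),
    holds_adj hw hσ', update_self, update_of_ne h3]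
  tauto

omit hw hT hσ in
theorem holds_merge {τ : Bool → List Bool} {d y₁ c₁ y₂ c₂ y c : Expr} :
    Holds τ σ (merge d y₁ c₁ y₂ c₂ y c) ↔ Merge (d.eval τ σ) (y₁.eval τ σ) (c₁.eval τ σ)
      (y₂.eval τ σ) (c₂.eval τ σ) (y.eval τ σ) (c.eval τ σ) := by
  simp only [merge, Merge, holds_or, holds_and, holds_not, holds_lt, holds_eq, eval]
  omega

theorem holds_next (h2 : σ 2 < w.length) (h3 : σ 3 < w.length) (h4 : σ 4 < w.length)
    (h5 : σ 5 < w.length) (h6 : σ 6 < w.length) :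
    Holds (tables w l) σ next ↔
      nextTable n w.length E T (σ 2) (σ 3) (σ 4) (σ 5) (σ 6) := by
  have hn := hw.lt
  refine holds_ex (eval_order hw hσ) fun v hv => ?_
  have hσ1 : update σ 7 v 0 = w.length := by simpa using hσ
  have hvw : v < w.length := hv.trans hn
  rw [holds_and, holds_selected hw hT hσ1 (by simp) (by simpa using hvw), holds_or, holds_and,
    holds_and, holds_not, holds_not, holds_eq, holds_and,
    holds_attached hw hT hσ1 (by simp) (by simp) (by simpa using h3),
    holds_row hT hσ1 (by simpa [eval] using h2) (by simpa [eval] using h3)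
      (by simpa [eval] using h4) (by simpa [eval] using h5) (by simpa [eval] using h6)]
  have e : ∀ i < 7, update σ 7 v i = σ i := fun i hi => update_of_ne (by omega) _ _
  simp only [eval, update_self, e _ (show 2 < 7 by omega), e _ (show 3 < 7 by omega),
    e _ (show 4 < 7 by omega), e _ (show 5 < 7 by omega), e _ (show 6 < 7 by omega)]
  refine and_congr_right fun _ => or_congr Iff.rfl (and_congr_right fun _ => ?_)
  refine holds_ex_var hσ1 fun y₁ hy₁ => holds_ex_var (by simpa using hσ) fun c₁ hc₁ =>
    holds_ex_var (by simpa using hσ) fun m₁ hm₁ => holds_ex_var (by simpa using hσ)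
    fun y₂ hy₂ => holds_ex_var (by simpa using hσ) fun c₂ hc₂ =>
    holds_ex_var (by simpa using hσ) fun m₂ hm₂ => ?_
  rw [holds_and, holds_and, holds_and, holds_merge, holds_eq, holds_row hT (by simpa using hσ),
    holds_row hT (by simpa using hσ)]
  · simp [eval]
  all_goals simp [eval, *]

omit hT in
theorem holds_init (h2 : σ 2 < w.length) :
    Holds (tables w l) σ init ↔
      initTable n w.length (σ 2) (σ 3) (σ 4) (σ 5) (σ 6) := by
  simp only [init, initTable, holds_or, holds_and, holds_lt, holds_eq, eval, eval_order hw hσ, h2,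
    true_and]

theorem holds_good {k : ℕ} (h2 : σ 2 < w.length) :
    Holds (tables w l) σ (good k) ↔ Good k n w.length T (σ 2) := by
  have hn := hw.lt
  rw [good, holds_or, holds_lt, eval_order hw hσ]
  refine or_congr Iff.rfl (holds_ex_var hσ fun d hd => holds_ex_var (by simpa using hσ)
    fun c hc => ?_)
  have hσ' : update (update σ 3 d) 4 c 0 = w.length := by simpa using hσ
  have ho := eval_order (l := l) hw hσ'
  rw [holds_and, holds_not, holds_lt, holds_row hT hσ', ho]
  · simp [eval]
  · simpa [eval] using hd
  · rw [ho]; exact hn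
  · simp [eval]; omega
  · simpa [eval] using hc
  · simpa [eval] using h2

-- Decoding needs no division: `rows` searches for entries whose code is the given position, and
-- `rowCode_inj` shows that only the intended ones fit.
omit hw hT hσ in
theorem agrees_tabulate {T' : Table} {e : Expr}
    (he : ∀ σ : ℕ → ℕ, σ 0 = w.length → σ 2 < w.length → σ 3 < w.length → σ 4 < w.length →
      σ 5 < w.length → σ 6 < w.length →
      (Holds (tables w l) σ e ↔ T' (σ 2) (σ 3) (σ 4) (σ 5) (σ 6))) :
    Agrees w.length (tabulate size (rows e) w l) T' := by
  intro d hd u hu y hy c hc m hm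
  have hlt := rowCode_lt hd hu hy hc hm
  have hv : valuation w.length 0 = w.length := by simp [valuation]
  set x := rowCode w.length d u y c m with hx
  have hget : (tabulate size (rows e) w l).getD x false = true ↔
      Holds (tables w l) (update (valuation w.length) 1 x) (rows e) := by
    rw [tabulate, List.getD_eq_getElem?_getD, List.getElem?_map, List.getElem?_range]
    · exact decide_eq_true_iff
    · simpa [size, eval, hv] using hlt
  rw [hget]
  have hσ : update (valuation w.length) 1 x 0 = w.length := by simp [hv]
  have key : Holds (tables w l) (update (valuation w.length) 1 x) (rows e) ↔
      ∃ d' < w.length, ∃ u' < w.length, ∃ y' < w.length, ∃ c' < w.length, ∃ m' < w.length,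
        x = rowCode w.length d' u' y' c' m' ∧ T' d' u' y' c' m' := by
    refine holds_ex_var hσ fun d' hd' => holds_ex_var (by simpa using hσ) fun u' hu' =>
      holds_ex_var (by simpa using hσ) fun y' hy' => holds_ex_var (by simpa using hσ)
      fun c' hc' => holds_ex_var (by simpa using hσ) fun m' hm' => ?_
    rw [holds_and, holds_eq, he]
    · simp [eval, code, rowCode, hv]
    all_goals simp [*]
  rw [key]
  constructor
  · rintro ⟨d', _, u', hu', y', hy', c', hc', m', hm', h, hT⟩
    obtain ⟨rfl, rfl, rfl, rfl, rfl⟩ := rowCode_inj hu hy hc hm hu' hy' hc' hm' h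
    exact hT
  · exact fun h => ⟨d, hd, u, hu, y, hy, c, hc, m, hm, rfl, h⟩

-- Agreement on entries below the input length is enough of an invariant, since for such entries
-- `nextTable` consults only rows of the same kind.
omit hT hσ in
theorem agrees_tableAfter (t : ℕ) :
    Agrees w.length (tableAfter size (rows init) (rows next) w t)
      ((nextTable n w.length E)^[t] (initTable n w.length)) := by
  induction t with
  | zero => exact agrees_tabulate fun σ hσ h2 _ _ _ _ => holds_init hw hσ h2
  | succ t ih =>
    rw [tableAfter, iterate_succ_apply', iterate_succ_apply']
    exact agrees_tabulate fun σ hσ h2 h3 h4 h5 h6 => holds_next hw ih hσ h2 h3 h4 h5 h6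

-- The expression `least` counts the `x` below the input length such that no `m ≤ x` is good. These
-- are the `x < f`, all within range because `f ≤ n`.
omit hT hσ in
theorem result_eq {k f : ℕ} (hk : 1 ≤ k)
    (hf : IsLeast {m | Good k n w.length
      ((nextTable n w.length E)^[n] (initTable n w.length)) m} f) :
    result size (rows init) (rows next) order (least k) w = f := by
  classical
  have hv : valuation w.length 0 = w.length := by simp [valuation]
  have hn := hw.lt
  have hfn : f ≤ n := hf.2 (Or.inl (by omega))
  rw [result, eval_order hw hv]
  set l := tableAfter size (rows init) (rows next) w n
  have h : ∀ x ∈ Finset.range w.length,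
      (not (ex 2 (add (var 1) (const 1)) (good k))).eval (tables w l)
        (update (valuation w.length) 1 x) = if x < f then 1 else 0 := fun x hx => by
    have hx := Finset.mem_range.1 hx
    have h : Holds (tables w l) (update (valuation w.length) 1 x)
        (ex 2 (add (var 1) (const 1)) (good k)) ↔ ∃ m < x + 1, Good k n w.length
          ((nextTable n w.length E)^[n] (initTable n w.length)) m :=
      holds_ex (by simp [eval]) fun m hm => by
        rw [holds_good hw (agrees_tableAfter hw n) (by simp [hv]) (by simp; omega), update_self]
    rw [eval_not, h]
    by_cases hxf : x < f
    · rw [if_pos hxf, if_neg]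
      rintro ⟨m, hm, hg⟩
      have := hf.2 hg
      omega
    · rw [if_neg hxf, if_pos ⟨f, by omega, hf.1⟩]
  have e : (var 0).eval (tables w l) (valuation w.length) = w.length := hv
  rw [least, eval, e, Finset.sum_congr rfl h, ← Finset.sum_filter, Finset.sum_const, smul_eq_mul,
    mul_one]
  have : (Finset.range w.length).filter (· < f) = Finset.range f := by
    ext x; simp; omega
  rw [this, Finset.card_range]

end Semantics

/-- Blocks of equal length `n` make row-by-row storage addressable by `a * n + b`. -/
theorem getElem?_flatMap_of_length {α β : Type*} (f : α → List β) {n : ℕ}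
    (hf : ∀ a, (f a).length = n) (l : List α) (a : ℕ) {b : ℕ} (hb : b < n) :
    (l.flatMap f)[a * n + b]? = l[a]?.bind fun x => (f x)[b]? := by
  induction l generalizing a with
  | nil => simp
  | cons x l ih =>
    rw [List.flatMap_cons]
    cases a with
    | zero => rw [List.getElem?_append_left (by rw [hf]; omega)]; simp
    | succ a =>
      rw [List.getElem?_append_right (by rw [hf, Nat.succ_mul]; omega), hf,
        show (a + 1) * n + b - n = a * n + b by rw [Nat.succ_mul]; omega, ih]
      simp

theorem encodes_encodeForest (F : FiniteForest) :
    Encodes (encodeForest F) F.order (natAdj F.graph) := by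
  classical
  refine ⟨by rw [length_encodeForest]; omega, fun x hx => ?_, ?_, fun a ha b hb => ?_,
    fun a b h => h.1, fun a b h => h.2.1⟩
  · rw [encodeForest, List.getD_eq_getElem?_getD, List.getElem?_append_left (by simpa using hx)]
    simp [hx]
  · rw [encodeForest, List.getD_eq_getElem?_getD, List.getElem?_append_right (by simp)]
    simp
  · have h1 : (encodeForest F)[F.order + 1 + (a * F.order + b)]? =
        (adjacencyBits F.graph)[a * F.order + b]? := by
      rw [encodeForest, List.getElem?_append_right (by simp; omega), List.length_replicate,
        show F.order + 1 + (a * F.order + b) - F.order = a * F.order + b + 1 by omega,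
        List.getElem?_cons_succ]
    rw [List.getD_eq_getElem?_getD, h1, adjacencyBits,
      getElem?_flatMap_of_length _ (by simp) _ _ hb]
    have h2 : natAdj F.graph a b ↔ F.graph.Adj ⟨a, ha⟩ ⟨b, hb⟩ := natAdj_val ⟨a, ha⟩ ⟨b, hb⟩
    simp [ha, hb, h2]

end Expr

end StackProg

theorem mainTheorem2 (k : ℕ) (hk : 2 ≤ k) :
    Nonempty (Turing.TM2ComputableInPolyTime encodeForest Computability.unaryEncodeNat
      (fun F : FiniteForest => equatingNumber k F.graph)) :=
  StackProg.Expr.nonempty_tm2ComputableInPolyTime _ _ _ _ _ fun F =>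
    StackProg.Expr.result_eq (StackProg.Expr.encodes_encodeForest F) (by omega : 1 ≤ k)
      (ForestTable.isLeast_good (by omega) (StackProg.Expr.encodes_encodeForest F).lt F.isAcyclic)
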